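/- Let $(X,\mathcal B,\mu)$ be a standard probability space with non-atomic measure $\mu$, and let $\mathrm{Aut}$ be the group of its invertible measure-preserving transformations (identified when they coincide $\mu$-almost everywhere). Let $\{A_i\}_{i\ge 0}$ be a sequence of measurable sets that is dense in $\mathcal B$ with respect to the distance $\mu(A\,\Delta\,B)$, and equip $\mathrm{Aut}$ with the Halmos metric $$\rho(S,T)=\sum_{i\ge 0} 2^{-i}\bigl(\mu(SA_i\,\Delta\,TA_i)+\mu(S^{-1}A_i\,\Delta\,T^{-1}A_i)\bigr).$$ A subset of $\mathrm{Aut}$ is called generic if it contains a dense $G_\delta$ subset of $(\mathrm{Aut},\rho)$. Let $K\subset\mathrm{Aut}$ be a compact set all of whose elements have zero Kolmogorov–Sinai entropy. Then the set $$K^{\mathrm{Aut}}=\{J^{-1}SJ:\ S\in K,\ J\in\mathrm{Aut}\}$$ of all transformations conjugate to elements of $K$ is of first category in $(\mathrm{Aut},\rho)$; in particular, it is not generic. -/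

import Mathlib

open MeasureTheory Filter

noncomputable section

namespace HalmosAut

variable {X : Type*} [MeasurableSpace X]

/-- The group of invertible bimeasurable transformations of `X` that preserve `μ`
(pointwise defined; multiplication is composition). -/
def MPGroup (μ : Measure X) : Subgroup (Equiv.Perm X) where
  carrier := {e | MeasurePreserving e μ μ ∧ MeasurePreserving e.symm μ μ}
  one_mem' := ⟨MeasurePreserving.id μ, MeasurePreserving.id μ⟩
  mul_mem' := fun ha hb => ⟨ha.1.comp hb.1, hb.2.comp ha.2⟩
  inv_mem' := fun ha => ⟨ha.2, ha.1⟩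

/-- The transformations that are equal to the identity almost everywhere. -/
def nullGroup (μ : Measure X) : Subgroup (MPGroup μ) where
  carrier := {e | ∀ᵐ x ∂μ, e.1 x = x}
  one_mem' := by
    change ∀ᵐ x ∂μ, (1 : Equiv.Perm X) x = x
    exact Eventually.of_forall fun _ => rfl
  mul_mem' := by
    intro a b ha hb
    change ∀ᵐ x ∂μ, a.1 (b.1 x) = x
    filter_upwards [b.2.1.quasiMeasurePreserving.ae ha, hb] with x h1 h2
    exact h1.trans h2
  inv_mem' := by
    intro a ha
    change ∀ᵐ x ∂μ, a.1.symm x = x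
    filter_upwards [a.2.2.quasiMeasurePreserving.ae ha] with x h1
    exact h1.symm.trans (a.1.apply_symm_apply x)

instance nullGroup_normal (μ : Measure X) : (nullGroup μ).Normal where
  conj_mem := by
    intro n hn g
    have h : ∀ᵐ x ∂μ, n.1 (g.1.symm x) = g.1.symm x := g.2.2.quasiMeasurePreserving.ae hn
    change ∀ᵐ x ∂μ, g.1 (n.1 (g.1.symm x)) = x
    filter_upwards [h] with x h1
    rw [h1]
    exact g.1.apply_symm_apply x

/-- `Aut(X, μ)`: the invertible measure-preserving transformations, identified when they agree
almost everywhere, with composition as group law. -/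
abbrev Aut (μ : Measure X) : Type _ := MPGroup μ ⧸ nullGroup μ

theorem ae_eq_of_rel {μ : Measure X} {s t : MPGroup μ}
    (h : QuotientGroup.leftRel (nullGroup μ) s t) : ∀ᵐ x ∂μ, s.1 x = t.1 x := by
  have h' : ∀ᵐ x ∂μ, s.1.symm (t.1 x) = x := QuotientGroup.leftRel_apply.1 h
  filter_upwards [h'] with x hx
  exact ((Equiv.symm_apply_eq _).1 hx).symm

theorem ae_symm_eq {μ : Measure X} {s t : MPGroup μ}
    (h : ∀ᵐ x ∂μ, s.1 x = t.1 x) : ∀ᵐ x ∂μ, s.1.symm x = t.1.symm x := by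
  filter_upwards [s.2.2.quasiMeasurePreserving.ae h] with x hx
  rw [Equiv.apply_symm_apply] at hx
  exact (Equiv.eq_symm_apply _).2 hx.symm

/-! ### The Halmos metric -/

/-- A sequence of measurable sets that is dense in the algebra of measurable sets with respect to
the distance `μ (A ∆ B)`. -/
structure DenseFamily (μ : Measure X) where
  /-- The sets of the family. -/
  set : ℕ → Set X
  measurableSet : ∀ i, MeasurableSet (set i)
  dense : ∀ B : Set X, MeasurableSet B → ∀ ε : ℝ, 0 < ε → ∃ i, μ.real (symmDiff (set i) B) < ε

/-- `μ(SA ∆ TA) + μ(S⁻¹A ∆ T⁻¹A)` for pointwise defined transformations. -/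
def setDist (μ : Measure X) (A : Set X) (s t : MPGroup μ) : ℝ :=
  μ.real (symmDiff (s.1 '' A) (t.1 '' A)) +
    μ.real (symmDiff (s.1.symm '' A) (t.1.symm '' A))

/-- `∑ᵢ 2⁻ⁱ (μ(SAᵢ ∆ TAᵢ) + μ(S⁻¹Aᵢ ∆ T⁻¹Aᵢ))` for pointwise defined transformations. -/
def preDist {μ : Measure X} (A : DenseFamily μ) (s t : MPGroup μ) : ℝ :=
  ∑' i : ℕ, (1 / 2 : ℝ) ^ i * setDist μ (A.set i) s t

theorem image_ae_eq {μ : Measure X} {s t : MPGroup μ} (h : ∀ᵐ x ∂μ, s.1 x = t.1 x) (A : Set X) :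
    (s.1 '' A : Set X) =ᵐ[μ] (t.1 '' A : Set X) := by
  rw [Equiv.image_eq_preimage_symm, Equiv.image_eq_preimage_symm]
  filter_upwards [ae_symm_eq h] with x hx
  change (s.1.symm x ∈ A) = (t.1.symm x ∈ A)
  rw [hx]

theorem symm_image_ae_eq {μ : Measure X} {s t : MPGroup μ} (h : ∀ᵐ x ∂μ, s.1 x = t.1 x)
    (A : Set X) : (s.1.symm '' A : Set X) =ᵐ[μ] (t.1.symm '' A : Set X) := by
  rw [Equiv.image_symm_eq_preimage, Equiv.image_symm_eq_preimage]
  filter_upwards [h] with x hx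
  change (s.1 x ∈ A) = (t.1 x ∈ A)
  rw [hx]

theorem preDist_congr {μ : Measure X} (A : DenseFamily μ) {s t s' t' : MPGroup μ}
    (hs : ∀ᵐ x ∂μ, s.1 x = s'.1 x) (ht : ∀ᵐ x ∂μ, t.1 x = t'.1 x) :
    preDist A s t = preDist A s' t' := by
  unfold preDist setDist
  congr 1
  funext i
  congr 2
  · exact measureReal_congr ((image_ae_eq hs _).symmDiff (image_ae_eq ht _))
  · exact measureReal_congr ((symm_image_ae_eq hs _).symmDiff (symm_image_ae_eq ht _))

/-- The Halmos distance on `Aut(X, μ)`. -/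
def halmosDist {μ : Measure X} (A : DenseFamily μ) (S T : Aut μ) : ℝ :=
  Quotient.liftOn₂ S T (preDist A) fun _ _ _ _ hs ht =>
    preDist_congr A (ae_eq_of_rel hs) (ae_eq_of_rel ht)

theorem setDist_nonneg (μ : Measure X) (A : Set X) (s t : MPGroup μ) : 0 ≤ setDist μ A s t :=
  add_nonneg measureReal_nonneg measureReal_nonneg

theorem summable_preDist {μ : Measure X} [IsProbabilityMeasure μ] (A : DenseFamily μ)
    (s t : MPGroup μ) : Summable fun i : ℕ => (1 / 2 : ℝ) ^ i * setDist μ (A.set i) s t := by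
  refine Summable.of_nonneg_of_le (fun i => mul_nonneg (by positivity) (setDist_nonneg _ _ _ _))
    (fun i => ?_) (summable_geometric_two.mul_right 2)
  refine mul_le_mul_of_nonneg_left ?_ (by positivity)
  have h1 := measureReal_le_one (μ := μ) (s := symmDiff (s.1 '' A.set i) (t.1 '' A.set i))
  have h2 := measureReal_le_one (μ := μ)
    (s := symmDiff (s.1.symm '' A.set i) (t.1.symm '' A.set i))
  unfold setDist
  linarith

theorem measureReal_symmDiff_triangle (μ : Measure X) [IsProbabilityMeasure μ] (A B C : Set X) :
    μ.real (symmDiff A C) ≤ μ.real (symmDiff A B) + μ.real (symmDiff B C) :=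
  (measureReal_mono (symmDiff_triangle A B C)).trans (measureReal_union_le _ _)

theorem setDist_triangle (μ : Measure X) [IsProbabilityMeasure μ] (A : Set X)
    (s t u : MPGroup μ) : setDist μ A s u ≤ setDist μ A s t + setDist μ A t u := by
  have h1 := measureReal_symmDiff_triangle μ (s.1 '' A) (t.1 '' A) (u.1 '' A)
  have h2 := measureReal_symmDiff_triangle μ (s.1.symm '' A) (t.1.symm '' A) (u.1.symm '' A)
  unfold setDist
  linarith

theorem measureReal_symm_image {μ : Measure X} (s : MPGroup μ) {B : Set X}
    (hB : MeasurableSet B) : μ.real (s.1.symm '' B) = μ.real B := by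
  rw [Equiv.image_symm_eq_preimage]
  exact s.2.1.measureReal_preimage hB.nullMeasurableSet

theorem ae_eq_of_preDist_eq_zero {μ : Measure X} [StandardBorelSpace X] [IsProbabilityMeasure μ]
    (A : DenseFamily μ) {s t : MPGroup μ} (h : preDist A s t = 0) :
    ∀ᵐ x ∂μ, s.1 x = t.1 x := by
  have hA : ∀ i, μ.real (symmDiff (s.1.symm '' A.set i) (t.1.symm '' A.set i)) = 0 := by
    intro i
    have hs : HasSum (fun i : ℕ => (1 / 2 : ℝ) ^ i * setDist μ (A.set i) s t) 0 := by
      rw [← h]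
      exact (summable_preDist A s t).hasSum
    have hp : ∀ i : ℕ, 0 ≤ (1 / 2 : ℝ) ^ i * setDist μ (A.set i) s t :=
      fun i => mul_nonneg (by positivity) (setDist_nonneg μ (A.set i) s t)
    have h0 := (hasSum_zero_iff_of_nonneg hp).1 hs
    have h1 := congrFun h0 i
    have h2 : setDist μ (A.set i) s t = 0 := by simpa using h1
    unfold setDist at h2
    have h3 : 0 ≤ μ.real (symmDiff (s.1 '' A.set i) (t.1 '' A.set i)) := measureReal_nonneg
    have h4 : 0 ≤ μ.real (symmDiff (s.1.symm '' A.set i) (t.1.symm '' A.set i)) :=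
      measureReal_nonneg
    linarith
  refine Filter.EventuallyEq.of_forall_separating_preimage (l := ae μ) MeasurableSet
    fun U hU => ?_
  rw [← measure_symmDiff_eq_zero_iff, ← measureReal_eq_zero_iff]
  refine le_antisymm (le_of_forall_pos_le_add fun ε hε => ?_) measureReal_nonneg
  obtain ⟨i, hi⟩ := A.dense U hU (ε / 2) (by positivity)
  have hd := (A.measurableSet i).symmDiff hU
  have e1 : μ.real (symmDiff (s.1.symm '' A.set i) (s.1.symm '' U)) < ε / 2 := by
    rw [← Set.image_symmDiff s.1.symm.injective, measureReal_symm_image s hd]; exact hi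
  have e2 : μ.real (symmDiff (t.1.symm '' A.set i) (t.1.symm '' U)) < ε / 2 := by
    rw [← Set.image_symmDiff t.1.symm.injective, measureReal_symm_image t hd]; exact hi
  have t1 := measureReal_symmDiff_triangle μ (s.1.symm '' U) (s.1.symm '' A.set i)
    (t.1.symm '' U)
  have t2 := measureReal_symmDiff_triangle μ (s.1.symm '' A.set i) (t.1.symm '' A.set i)
    (t.1.symm '' U)
  rw [symmDiff_comm] at e1
  have e0 := hA i
  rw [Equiv.image_symm_eq_preimage, Equiv.image_symm_eq_preimage] at t1
  rw [Equiv.image_symm_eq_preimage] at e1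
  rw [Equiv.image_symm_eq_preimage t.1 U] at e2
  rw [Equiv.image_symm_eq_preimage t.1 U] at t2
  linarith

/-- `Aut(X, μ)` as a metric space under the Halmos metric given by a dense family of sets. -/
@[reducible] def halmosMetricSpace {μ : Measure X} [StandardBorelSpace X] [IsProbabilityMeasure μ]
    (A : DenseFamily μ) : MetricSpace (Aut μ) where
  dist := halmosDist A
  dist_self := by
    rintro ⟨s⟩
    change preDist A s s = 0
    simp [preDist, setDist]
  dist_comm := by
    rintro ⟨s⟩ ⟨t⟩
    change preDist A s t = preDist A t s
    simp [preDist, setDist, symmDiff_comm]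
  dist_triangle := by
    rintro ⟨s⟩ ⟨t⟩ ⟨u⟩
    change preDist A s u ≤ preDist A s t + preDist A t u
    unfold preDist
    rw [← (summable_preDist A s t).tsum_add (summable_preDist A t u)]
    refine (summable_preDist A s u).tsum_le_tsum (fun i => ?_)
      ((summable_preDist A s t).add (summable_preDist A t u))
    rw [← mul_add]
    exact mul_le_mul_of_nonneg_left (setDist_triangle μ _ s t u) (by positivity)
  eq_of_dist_eq_zero := by
    rintro ⟨s⟩ ⟨t⟩ h
    refine QuotientGroup.eq.2 ?_
    change ∀ᵐ x ∂μ, s.1.symm (t.1 x) = x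
    filter_upwards [ae_eq_of_preDist_eq_zero A h] with x hx
    rw [← hx]
    exact s.1.symm_apply_apply x

/-! ### Kolmogorov–Sinai entropy -/

/-- Shannon entropy `-∑ μ(C) ln μ(C)` of the finite partition of `X` into the fibres of `ξ`. -/
def partitionEntropy {α : Type*} [Fintype α] (μ : Measure X) (ξ : X → α) : ℝ :=
  ∑ a : α, Real.negMulLog (μ.real (ξ ⁻¹' {a}))

/-- The label of the join `ξ ∨ T⁻¹ξ ∨ ⋯ ∨ T⁻⁽ⁿ⁻¹⁾ξ`, where `ξ` is a finite partition given by its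
labelling function. -/
def itinerary {k : ℕ} (T : X → X) (ξ : X → Fin k) (n : ℕ) : X → (Fin n → Fin k) :=
  fun x i => ξ (T^[i] x)

/-- `h(T, ξ) = lim (1/n) H(ξ ∨ T⁻¹ξ ∨ ⋯ ∨ T⁻⁽ⁿ⁻¹⁾ξ)`, written as an upper limit. -/
def entropyWrt {k : ℕ} (μ : Measure X) (T : X → X) (ξ : X → Fin k) : ENNReal :=
  limsup (fun n : ℕ => ENNReal.ofReal (partitionEntropy μ (itinerary T ξ n) / n)) atTop

/-- The entropy of a map: supremum of `h(T, ξ)` over all finite measurable partitions `ξ`. -/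
def mapEntropy (μ : Measure X) (T : X → X) : ENNReal :=
  ⨆ (k : ℕ) (ξ : X → Fin k) (_ : Measurable ξ), entropyWrt μ T ξ

theorem mapEntropy_congr {μ : Measure X} {s t : MPGroup μ} (h : ∀ᵐ x ∂μ, s.1 x = t.1 x) :
    mapEntropy μ s.1 = mapEntropy μ t.1 := by
  have hit : ∀ n : ℕ, ∀ᵐ x ∂μ, s.1^[n] x = t.1^[n] x := by
    intro n
    induction n with
    | zero => exact Eventually.of_forall fun _ => rfl
    | succ n ih =>
      filter_upwards [h, t.2.1.quasiMeasurePreserving.ae ih] with x h1 h2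
      rw [Function.iterate_succ_apply, Function.iterate_succ_apply, h1, h2]
  have key : ∀ (k : ℕ) (ξ : X → Fin k), entropyWrt μ s.1 ξ = entropyWrt μ t.1 ξ := by
    intro k ξ
    unfold entropyWrt partitionEntropy
    congr 1
    funext n
    congr 2
    refine Finset.sum_congr rfl fun a _ => ?_
    congr 1
    refine measureReal_congr ?_
    filter_upwards [ae_all_iff.2 hit] with x hx
    have : itinerary s.1 ξ n x = itinerary t.1 ξ n x := by
      funext i
      simp only [itinerary, hx]
    change (itinerary s.1 ξ n x = a) = (itinerary t.1 ξ n x = a)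
    rw [this]
  simp only [mapEntropy, key]

/-- Kolmogorov–Sinai entropy of an element of `Aut(X, μ)`. -/
def ksEntropy {μ : Measure X} (S : Aut μ) : ENNReal :=
  Quotient.liftOn S (fun s => mapEntropy μ s.1) fun _ _ h => mapEntropy_congr (ae_eq_of_rel h)

/-! ### Conjugacy saturation and genericity -/

/-- `K^Aut = {J⁻¹ S J : S ∈ K, J ∈ Aut}`. -/
def conjSaturation {μ : Measure X} (K : Set (Aut μ)) : Set (Aut μ) :=
  {T | ∃ S ∈ K, ∃ J : Aut μ, T = J⁻¹ * S * J}

/-- A set is generic if it contains a dense `Gδ` set. -/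
def IsGeneric {Y : Type*} [TopologicalSpace Y] (s : Set Y) : Prop :=
  ∃ G ⊆ s, IsGδ G ∧ Dense G

end HalmosAut

end

open HalmosAut

/-!
The proof compares the entropy of a partition along arithmetic progressions
`0, j + 1, …, (L j - 1) * (j + 1)` for elements of `K` and for generic transformations.

Elements of zero entropy have zero entropy along every fixed progression, so compactness of `K`
yields lengths `L j > 0` for which the entropy of `{A m, (A m)ᶜ}` along the `j`-th progression is
at most `L j / (j + 1)`, uniformly over `K` and over `m < j`. As `A` is dense, the entropy of
`{C, Cᶜ}` is then `o(L j)` for every measurable set `C`, and in this form the bound is invariant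
under conjugation.

For a set `B` of measure `1 / 2` a generic `T` violates it. To perturb a given `S`, consider the
skew product over the clock `c ↦ c + 1` of `Fin (j + 1)` with fibre `X ^ L j` which acts diagonally
by `S` and also rotates the coordinates when the clock shows `0`. All atomless standard spaces being
isomorphic, it can be transported to `X` so that the sets `A i`, `S⁻¹ A i`, for `i < j`, and `B`
correspond to the same conditions on the coordinate `0`. The transported map then agrees with `S`
as far as these `A i` are concerned, off a set of measure `1 / (j + 1)`.
But its `(j + 1)`-st power reads a new coordinate at every step, so along the progression `B` is
independent and has entropy `L j * log 2`. Having entropy above `L j * (log 2 / 2)` for infinitely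
many `j` is therefore a dense `Gδ` condition.

The Halmos metric is complete, so by Baire's theorem a meagre set contains no dense `Gδ` set.
-/

noncomputable section

namespace HalmosAut

/-! ### Shannon entropy -/

section ShannonEntropy

theorem negMulLog_sum_le_sum_negMulLog {ι : Type*} {s : Finset ι} {p : ι → ℝ}
    (hp : ∀ i ∈ s, 0 ≤ p i) :
    Real.negMulLog (∑ i ∈ s, p i) ≤ ∑ i ∈ s, Real.negMulLog (p i) := by
  rw [Real.negMulLog, neg_mul, Finset.sum_mul, ← Finset.sum_neg_distrib]
  refine Finset.sum_le_sum fun i hi => ?_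
  rw [Real.negMulLog, neg_mul, neg_le_neg_iff]
  rcases (hp i hi).eq_or_lt with hi0 | hi0
  · simp [← hi0]
  · exact mul_le_mul_of_nonneg_left (Real.log_le_log hi0 (Finset.single_le_sum hp hi)) hi0.le

theorem negMulLog_le_neg_mul_log_add {p q : ℝ} (hp : 0 ≤ p) (hq : 0 ≤ q) (hpq : q = 0 → p = 0) :
    Real.negMulLog p ≤ -(p * Real.log q) + (q - p) := by
  rcases hp.eq_or_lt with rfl | hp0
  · simpa using hq
  have hq0 : 0 < q := hq.lt_of_ne fun h => hp0.ne' (hpq h.symm)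
  have hlog := mul_le_mul_of_nonneg_left
    (Real.log_le_sub_one_of_pos (div_pos hq0 hp0)) hp
  rw [Real.log_div hq0.ne' hp0.ne', mul_sub, mul_sub, mul_div_cancel₀ _ hp0.ne', mul_one] at hlog
  rw [Real.negMulLog]
  linarith

theorem sum_negMulLog_le_sum_neg_mul_log {ι : Type*} {s : Finset ι} {p q : ι → ℝ}
    (hp : ∀ i ∈ s, 0 ≤ p i) (hq : ∀ i ∈ s, 0 ≤ q i) (hpq : ∀ i ∈ s, q i = 0 → p i = 0)
    (hsum : ∑ i ∈ s, q i ≤ ∑ i ∈ s, p i) :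
    ∑ i ∈ s, Real.negMulLog (p i) ≤ ∑ i ∈ s, -(p i * Real.log (q i)) := by
  have h := Finset.sum_le_sum fun i hi =>
    negMulLog_le_neg_mul_log_add (hp i hi) (hq i hi) (hpq i hi)
  rw [Finset.sum_add_distrib, Finset.sum_sub_distrib] at h
  linarith

variable {X α β : Type*} [MeasurableSpace X] {μ : Measure X} [Fintype α]

theorem partitionEntropy_congr_ae {ξ η : X → α} (h : ξ =ᵐ[μ] η) :
    partitionEntropy μ ξ = partitionEntropy μ η :=
  Finset.sum_congr rfl fun _ _ => congrArg _ (measureReal_congr (h.preimage _))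

variable [MeasurableSpace α] [MeasurableSingletonClass α]

theorem partitionEntropy_comp_measurePreserving {Y : Type*} [MeasurableSpace Y] {ν : Measure Y}
    {ξ : X → α} (hξ : Measurable ξ) {f : Y → X} (hf : MeasurePreserving f ν μ) :
    partitionEntropy ν (ξ ∘ f) = partitionEntropy μ ξ :=
  Finset.sum_congr rfl fun a _ => congrArg _
    (hf.measureReal_preimage (hξ (measurableSet_singleton a)).nullMeasurableSet)

theorem sum_measureReal_inter_preimage_singleton [IsFiniteMeasure μ] {ξ : X → α}
    (hξ : Measurable ξ) (s : Set X) : ∑ a, μ.real (s ∩ ξ ⁻¹' {a}) = μ.real s := by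
  have h := sum_measureReal_preimage_singleton (μ := μ.restrict s) Finset.univ
    fun a _ => hξ (measurableSet_singleton a)
  simpa [measureReal_restrict_apply (hξ (measurableSet_singleton _)), Set.inter_comm] using h

variable [Fintype β]

theorem partitionEntropy_comp_le [IsFiniteMeasure μ] {ξ : X → α} (hξ : Measurable ξ)
    (f : α → β) : partitionEntropy μ (f ∘ ξ) ≤ partitionEntropy μ ξ := by
  classical
  rw [partitionEntropy, partitionEntropy, ← Finset.sum_fiberwise (s := Finset.univ) (g := f)]
  refine Finset.sum_le_sum fun b _ => ?_
  have hfiber : μ.real ((f ∘ ξ) ⁻¹' {b}) = ∑ a with f a = b, μ.real (ξ ⁻¹' {a}) := by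
    rw [sum_measureReal_preimage_singleton _ fun a _ => hξ (measurableSet_singleton a)]
    congr 1
    ext x
    simp
  rw [hfiber]
  exact negMulLog_sum_le_sum_negMulLog fun _ _ => measureReal_nonneg

variable [MeasurableSpace β] [MeasurableSingletonClass β]

theorem partitionEntropy_prodMk_le [IsProbabilityMeasure μ] {ξ : X → α} {η : X → β}
    (hξ : Measurable ξ) (hη : Measurable η) :
    partitionEntropy μ (fun x => (ξ x, η x)) ≤ partitionEntropy μ ξ + partitionEntropy μ η := by
  let p (c : α × β) : ℝ := μ.real (ξ ⁻¹' {c.1} ∩ η ⁻¹' {c.2})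
  let u (a : α) : ℝ := μ.real (ξ ⁻¹' {a})
  let v (b : β) : ℝ := μ.real (η ⁻¹' {b})
  have hpu (a : α) : ∑ b, p (a, b) = u a :=
    sum_measureReal_inter_preimage_singleton hη (ξ ⁻¹' {a})
  have hpv (b : β) : ∑ a, p (a, b) = v b := by
    simp only [p, Set.inter_comm (ξ ⁻¹' _)]
    exact sum_measureReal_inter_preimage_singleton hξ (η ⁻¹' {b})
  have hu : ∑ a, u a = 1 := by
    simpa using sum_measureReal_inter_preimage_singleton (μ := μ) hξ Set.univ
  have hv : ∑ b, v b = 1 := by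
    simpa using sum_measureReal_inter_preimage_singleton (μ := μ) hη Set.univ
  have hle_u (c : α × β) : p c ≤ u c.1 := measureReal_mono Set.inter_subset_left
  have hle_v (c : α × β) : p c ≤ v c.2 := measureReal_mono Set.inter_subset_right
  have hp (c : α × β) : 0 ≤ p c := measureReal_nonneg
  have hlog (c : α × β) : -(p c * Real.log (u c.1 * v c.2)) =
      -(p c * Real.log (u c.1)) + -(p c * Real.log (v c.2)) := by
    rcases (hp c).eq_or_lt with h0 | h0
    · simp [← h0]
    · rw [Real.log_mul (h0.trans_le (hle_u c)).ne' (h0.trans_le (hle_v c)).ne']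
      ring
  calc partitionEntropy μ (fun x => (ξ x, η x))
      = ∑ c, Real.negMulLog (p c) := by
        refine Finset.sum_congr rfl fun c _ => congrArg _ (congrArg μ.real ?_)
        rw [← Set.mk_preimage_prod, Set.singleton_prod_singleton]
    _ ≤ ∑ c, -(p c * Real.log (u c.1 * v c.2)) := by
        refine sum_negMulLog_le_sum_neg_mul_log (fun c _ => hp c)
          (fun c _ => mul_nonneg measureReal_nonneg measureReal_nonneg) (fun c _ h0 => ?_) ?_
        · rcases mul_eq_zero.1 h0 with h0 | h0
          · exact ((hle_u c).trans h0.le).antisymm (hp c)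
          · exact ((hle_v c).trans h0.le).antisymm (hp c)
        · simp only [Fintype.sum_prod_type, hpu, hu, ← Finset.mul_sum, hv, mul_one, le_refl]
    _ = partitionEntropy μ ξ + partitionEntropy μ η := by
        simp only [hlog, Finset.sum_add_distrib, Fintype.sum_prod_type]
        rw [Finset.sum_comm (f := fun a b => -(p (a, b) * Real.log (v b)))]
        simp only [Finset.sum_neg_distrib, ← Finset.sum_mul, hpu, hpv, partitionEntropy,
          Real.negMulLog, neg_mul, u, v]

theorem sum_negMulLog_prod {ι α : Type*} [Fintype ι] [DecidableEq ι] [Fintype α]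
    {p : ι → α → ℝ} (hp : ∀ i, ∑ b, p i b = 1) :
    ∑ a : ι → α, Real.negMulLog (∏ i, p i (a i)) = ∑ i, ∑ b, Real.negMulLog (p i b) := by
  have hlog (a : ι → α) : Real.negMulLog (∏ i, p i (a i)) =
      ∑ i, ∏ j, Function.update p i (fun b => Real.negMulLog (p i b)) j (a j) := by
    have hupdate (i : ι) : ∏ j, Function.update p i (fun b => Real.negMulLog (p i b)) j (a j) =
        -(∏ j, p j (a j)) * Real.log (p i (a i)) := by
      rw [← Finset.mul_prod_erase _ _ (Finset.mem_univ i),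
        ← Finset.mul_prod_erase _ (fun j => p j (a j)) (Finset.mem_univ i),
        Function.update_self, Finset.prod_congr rfl fun j hj =>
          congrFun (Function.update_of_ne (Finset.ne_of_mem_erase hj) _ p) (a j), Real.negMulLog]
      ring
    rw [Finset.sum_congr rfl fun i _ => hupdate i, ← Finset.mul_sum, Real.negMulLog]
    by_cases h0 : ∏ j, p j (a j) = 0
    · rw [h0, neg_zero, zero_mul, zero_mul]
    · rw [Real.log_prod fun i hi => Finset.prod_ne_zero_iff.1 h0 i hi]
  simp only [hlog]
  rw [Finset.sum_comm]
  refine Finset.sum_congr rfl fun i _ => ?_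
  rw [← Fintype.prod_sum, ← Finset.mul_prod_erase _ _ (Finset.mem_univ i), Function.update_self,
    Finset.prod_eq_one fun j hj => ?_, mul_one]
  rw [Function.update_of_ne (Finset.ne_of_mem_erase hj), hp]

theorem partitionEntropy_pi {ι α : Type*} [Fintype ι] [DecidableEq ι] [Fintype α]
    [MeasurableSpace α] [MeasurableSingletonClass α] {Y : ι → Type*} [∀ i, MeasurableSpace (Y i)]
    {μ : ∀ i, Measure (Y i)} [∀ i, IsProbabilityMeasure (μ i)] {ξ : ∀ i, Y i → α}
    (hξ : ∀ i, Measurable (ξ i)) :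
    partitionEntropy (Measure.pi μ) (fun y i => ξ i (y i)) =
      ∑ i, partitionEntropy (μ i) (ξ i) := by
  have hfiber (a : ι → α) : (Measure.pi μ).real ((fun y i => ξ i (y i)) ⁻¹' {a}) =
      ∏ i, (μ i).real (ξ i ⁻¹' {a i}) := by
    have : (fun (y : ∀ i, Y i) i => ξ i (y i)) ⁻¹' {a} =
        Set.univ.pi fun i => ξ i ⁻¹' {a i} := by
      ext y
      simp [funext_iff]
    rw [this, measureReal_def, Measure.pi_pi, ENNReal.toReal_prod]
    rfl
  simp only [partitionEntropy, hfiber]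
  refine sum_negMulLog_prod (p := fun i b => (μ i).real (ξ i ⁻¹' {b})) fun i => ?_
  simpa using sum_measureReal_inter_preimage_singleton (μ := μ i) (hξ i) Set.univ

end ShannonEntropy

/-! ### Itineraries -/

section Itinerary

variable {X : Type*} [MeasurableSpace X] {μ : Measure X} {k : ℕ} {T : X → X}
  {ξ : X → Fin k}

theorem measurable_itinerary (hT : Measurable T) (hξ : Measurable ξ) (n : ℕ) :
    Measurable (itinerary T ξ n) :=
  measurable_pi_lambda _ fun i => hξ.comp (hT.iterate i)

theorem itinerary_congr_ae {S : X → X} (hT : Measure.QuasiMeasurePreserving T μ μ)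
    (h : S =ᵐ[μ] T) (ξ : X → Fin k) (n : ℕ) : itinerary S ξ n =ᵐ[μ] itinerary T ξ n := by
  have hiter : ∀ i : ℕ, S^[i] =ᵐ[μ] T^[i] := by
    intro i
    induction i with
    | zero => rfl
    | succ i ih =>
      filter_upwards [h, hT.ae_eq_comp ih] with x hx hx'
      rw [Function.iterate_succ_apply, Function.iterate_succ_apply, hx]
      exact hx'
  filter_upwards [ae_all_iff.2 hiter] with x hx
  exact funext fun i => congrArg ξ (hx i)

variable [IsProbabilityMeasure μ]

theorem partitionEntropy_itinerary_zero (T : X → X) (ξ : X → Fin k) :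
    partitionEntropy μ (itinerary T ξ 0) = 0 := by
  refine Finset.sum_eq_zero fun a _ => ?_
  have hfiber : itinerary T ξ 0 ⁻¹' {a} = Set.univ :=
    Set.eq_univ_of_forall fun x => Subsingleton.elim (itinerary T ξ 0 x) a
  simp [hfiber]

theorem partitionEntropy_itinerary_add_le (hT : MeasurePreserving T μ μ) (hξ : Measurable ξ)
    (m n : ℕ) :
    partitionEntropy μ (itinerary T ξ (m + n)) ≤
      partitionEntropy μ (itinerary T ξ m) + partitionEntropy μ (itinerary T ξ n) := by
  have hm := measurable_itinerary hT.measurable hξ m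
  have hn := measurable_itinerary hT.measurable hξ n
  have hn' : Measurable (itinerary T ξ n ∘ T^[m]) := hn.comp (hT.iterate m).measurable
  have happend : itinerary T ξ (m + n) = (fun p : (Fin m → Fin k) × (Fin n → Fin k) =>
      Fin.append p.1 p.2) ∘ fun x => (itinerary T ξ m x, (itinerary T ξ n ∘ T^[m]) x) := by
    funext x i
    refine Fin.addCases (fun i => ?_) (fun i => ?_) i
    · simp [itinerary]
    · simp [itinerary, ← Function.iterate_add_apply, add_comm]
  calc partitionEntropy μ (itinerary T ξ (m + n))
      ≤ partitionEntropy μ fun x => (itinerary T ξ m x, (itinerary T ξ n ∘ T^[m]) x) :=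
        happend ▸ partitionEntropy_comp_le (hm.prodMk hn') _
    _ ≤ partitionEntropy μ (itinerary T ξ m) + partitionEntropy μ (itinerary T ξ n ∘ T^[m]) :=
        partitionEntropy_prodMk_le hm hn'
    _ = _ := by rw [partitionEntropy_comp_measurePreserving hn (hT.iterate m)]

theorem partitionEntropy_itinerary_mul_le (hT : MeasurePreserving T μ μ) (hξ : Measurable ξ)
    (m n : ℕ) :
    partitionEntropy μ (itinerary T ξ (m * n)) ≤ m * partitionEntropy μ (itinerary T ξ n) := by
  induction m with
  | zero => rw [zero_mul, partitionEntropy_itinerary_zero, Nat.cast_zero, zero_mul]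
  | succ m ih =>
    rw [Nat.succ_mul]
    have hadd := partitionEntropy_itinerary_add_le hT hξ (m * n) n
    push_cast
    linarith

theorem partitionEntropy_itinerary_le (hT : MeasurePreserving T μ μ) (hξ : Measurable ξ)
    (n : ℕ) : partitionEntropy μ (itinerary T ξ n) ≤ n * partitionEntropy μ ξ := by
  have hmul := partitionEntropy_itinerary_mul_le hT hξ n 1
  rw [mul_one] at hmul
  refine hmul.trans (mul_le_mul_of_nonneg_left ?_ (Nat.cast_nonneg n))
  have hone : itinerary T ξ 1 = (fun a _ => a) ∘ ξ := by
    funext x i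
    simp [itinerary]
  exact hone ▸ partitionEntropy_comp_le hξ _

theorem partitionEntropy_itinerary_iterate_le (hT : Measurable T) (hξ : Measurable ξ) {j : ℕ}
    (hj : 0 < j) (n : ℕ) :
    partitionEntropy μ (itinerary T^[j] ξ n) ≤ partitionEntropy μ (itinerary T ξ (j * n)) := by
  have hsub : itinerary T^[j] ξ n = (fun a (i : Fin n) =>
      a (⟨j * i, Nat.mul_lt_mul_of_pos_left i.2 hj⟩ : Fin (j * n))) ∘ itinerary T ξ (j * n) := by
    funext x i
    simp [itinerary, Function.iterate_mul]
  exact hsub ▸ partitionEntropy_comp_le (measurable_itinerary hT hξ _) _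

theorem partitionEntropy_itinerary_le_add {l m : ℕ} (hT : MeasurePreserving T μ μ)
    {η : X → Fin l} {ζ : X → Fin m} (hη : Measurable η) (hζ : Measurable ζ)
    (f : Fin l → Fin m → Fin k) (n : ℕ) :
    partitionEntropy μ (itinerary T (fun x => f (η x) (ζ x)) n) ≤
      partitionEntropy μ (itinerary T η n) + n * partitionEntropy μ ζ := by
  have hη' := measurable_itinerary hT.measurable hη n
  have hζ' := measurable_itinerary hT.measurable hζ n
  calc partitionEntropy μ (itinerary T (fun x => f (η x) (ζ x)) n)
      ≤ partitionEntropy μ fun x => (itinerary T η n x, itinerary T ζ n x) :=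
        partitionEntropy_comp_le (hη'.prodMk hζ') fun p i => f (p.1 i) (p.2 i)
    _ ≤ partitionEntropy μ (itinerary T η n) + partitionEntropy μ (itinerary T ζ n) :=
        partitionEntropy_prodMk_le hη' hζ'
    _ ≤ _ := add_le_add_right (partitionEntropy_itinerary_le hT hζ n) _

end Itinerary

section TwoSetLabel

variable {X : Type*}

/-- The labelling of the partition `{B, Bᶜ}`: label `1` on `B` and label `0` off `B`. -/
def twoSetLabel (B : Set X) : X → Fin 2 := B.indicator 1

@[simp] theorem twoSetLabel_preimage_one (B : Set X) :
    twoSetLabel B ⁻¹' {1} = B := by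
  ext x
  by_cases hx : x ∈ B <;> simp [twoSetLabel, hx]

@[simp] theorem twoSetLabel_preimage_zero (B : Set X) :
    twoSetLabel B ⁻¹' {0} = Bᶜ := by
  ext x
  by_cases hx : x ∈ B <;> simp [twoSetLabel, hx]

theorem twoSetLabel_eq_add_symmDiff (B C : Set X) :
    twoSetLabel B = fun x => twoSetLabel C x + twoSetLabel (symmDiff C B) x := by
  classical
  funext x
  by_cases hB : x ∈ B <;> by_cases hC : x ∈ C <;>
    simp [twoSetLabel, Set.indicator, hB, hC, Set.mem_symmDiff]

variable [MeasurableSpace X]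

theorem measurable_twoSetLabel {B : Set X} (hB : MeasurableSet B) : Measurable (twoSetLabel B) :=
  measurable_one.indicator hB

theorem partitionEntropy_twoSetLabel {μ : Measure X} [IsProbabilityMeasure μ] {B : Set X}
    (hB : MeasurableSet B) : partitionEntropy μ (twoSetLabel B) = Real.binEntropy (μ.real B) := by
  rw [partitionEntropy, Fin.sum_univ_two, twoSetLabel_preimage_zero, twoSetLabel_preimage_one,
    probReal_compl_eq_one_sub hB, Real.binEntropy_eq_negMulLog_add_negMulLog_one_sub, add_comm]

end TwoSetLabel

section Aut

variable {X : Type*} [MeasurableSpace X] {μ : Measure X} {k : ℕ} {ξ : X → Fin k}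

theorem coe_pow_eq_iterate (s : MPGroup μ) (j : ℕ) : ⇑(s ^ j).1 = (⇑s.1)^[j] := by
  rw [Subgroup.coe_pow, Equiv.Perm.coe_pow]

/-- The entropy of the partition `ξ ∨ T⁻¹ξ ∨ ⋯ ∨ T⁻⁽ⁿ⁻¹⁾ξ` as a function of `T`. Its value at
`T ^ j` is the entropy of `ξ` along the arithmetic progression `0, j, …, (n - 1) * j`. -/
def itineraryEntropy (ξ : X → Fin k) (n : ℕ) : Aut μ → ℝ :=
  Quotient.lift (fun s : MPGroup μ => partitionEntropy μ (itinerary s.1 ξ n)) fun _ t h =>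
    partitionEntropy_congr_ae (itinerary_congr_ae t.2.1.quasiMeasurePreserving (ae_eq_of_rel h) ξ n)

theorem itineraryEntropy_conj (hξ : Measurable ξ) (n : ℕ) (S : Aut μ) (t : MPGroup μ) :
    itineraryEntropy ξ n ((t : Aut μ)⁻¹ * S * (t : Aut μ)) =
      itineraryEntropy (ξ ∘ t.1.symm) n S := by
  rcases S with ⟨s⟩
  have hsemiconj : Function.Semiconj t.1 (t⁻¹ * s * t : MPGroup μ).1 s.1 :=
    fun x => t.1.apply_symm_apply (s.1 (t.1 x))
  have hitinerary : itinerary (t⁻¹ * s * t : MPGroup μ).1 ξ n =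
      itinerary s.1 (ξ ∘ t.1.symm) n ∘ t.1 := by
    funext x i
    simp only [itinerary, Function.comp_apply, ← (hsemiconj.iterate_right i).eq x,
      Equiv.symm_apply_apply]
  change partitionEntropy μ (itinerary (t⁻¹ * s * t : MPGroup μ).1 ξ n) = _
  rw [hitinerary]
  exact partitionEntropy_comp_measurePreserving
    (measurable_itinerary s.2.1.measurable (hξ.comp t.2.2.measurable) n) t.2.1

variable [IsProbabilityMeasure μ]

theorem itineraryEntropy_mul_le (hξ : Measurable ξ) (m n : ℕ) (S : Aut μ) :
    itineraryEntropy ξ (m * n) S ≤ m * itineraryEntropy ξ n S := by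
  rcases S with ⟨s⟩
  exact partitionEntropy_itinerary_mul_le s.2.1 hξ m n

theorem itineraryEntropy_twoSetLabel_le {B C : Set X} (hB : MeasurableSet B)
    (hC : MeasurableSet C) (n : ℕ) (S : Aut μ) :
    itineraryEntropy (twoSetLabel B) n S ≤
      itineraryEntropy (twoSetLabel C) n S + n * Real.binEntropy (μ.real (symmDiff C B)) := by
  rcases S with ⟨s⟩
  rw [twoSetLabel_eq_add_symmDiff B C, ← partitionEntropy_twoSetLabel (hC.symmDiff hB)]
  exact partitionEntropy_itinerary_le_add s.2.1 (measurable_twoSetLabel hC)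
    (measurable_twoSetLabel (hC.symmDiff hB)) (· + ·) n

theorem eventually_itineraryEntropy_pow_lt {S : Aut μ} (hS : ksEntropy S = 0)
    (hξ : Measurable ξ) {j : ℕ} (hj : 0 < j) {ε : ℝ} (hε : 0 < ε) :
    ∀ᶠ n : ℕ in atTop, itineraryEntropy ξ n (S ^ j) < n * ε := by
  rcases S with ⟨s⟩
  have hzero : entropyWrt μ s.1 ξ = 0 := by
    refine le_antisymm (le_trans ?_ (le_of_eq hS)) bot_le
    exact le_iSup_of_le k (le_iSup_of_le ξ (le_iSup_of_le hξ le_rfl))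
  have hj' : (0 : ℝ) < j := Nat.cast_pos.2 hj
  have hlimsup : ∀ᶠ n : ℕ in atTop, ENNReal.ofReal
      (partitionEntropy μ (itinerary s.1 ξ n) / n) < ENNReal.ofReal (ε / j) := by
    refine eventually_lt_of_limsup_lt (hzero.trans_lt ?_)
    exact ENNReal.ofReal_pos.2 (div_pos hε hj')
  filter_upwards [(tendsto_id.const_mul_atTop' hj).eventually hlimsup, eventually_gt_atTop 0]
    with n hn hn0
  have : (0 : ℝ) < n := Nat.cast_pos.2 hn0
  have hlt := (ENNReal.ofReal_lt_ofReal_iff (by positivity)).1 hn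
  simp only [id_eq, Nat.cast_mul] at hlt
  calc partitionEntropy μ (itinerary (s ^ j).1 ξ n)
      ≤ partitionEntropy μ (itinerary s.1 ξ (j * n)) := by
        rw [coe_pow_eq_iterate]
        exact partitionEntropy_itinerary_iterate_le s.2.1.measurable hξ hj n
    _ < ε / j * (j * n) := (div_lt_iff₀ (by positivity)).1 hlt
    _ = n * ε := by field_simp

end Aut

/-! ### Isomorphisms of atomless measures -/

section MeasureIso

open Set ProbabilityTheory

variable {X Y Z : Type*} [MeasurableSpace X] [MeasurableSpace Y] [MeasurableSpace Z]
  {μ : Measure X} {ν : Measure Y} {ρ : Measure Z}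

/-- `φ` is an isomorphism of measure spaces modulo null sets, with inverse `ψ`. -/
structure IsMeasureIso (μ : Measure X) (ν : Measure Y) (φ : X → Y) (ψ : Y → X) : Prop where
  measurePreserving : MeasurePreserving φ μ ν
  measurePreserving_inv : MeasurePreserving ψ ν μ
  left_inv : ∀ᵐ x ∂μ, ψ (φ x) = x
  right_inv : ∀ᵐ y ∂ν, φ (ψ y) = y

namespace IsMeasureIso

variable {φ : X → Y} {ψ : Y → X} {φ' : Y → Z} {ψ' : Z → Y}

theorem symm (h : IsMeasureIso μ ν φ ψ) : IsMeasureIso ν μ ψ φ :=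
  ⟨h.2, h.1, h.4, h.3⟩

theorem trans (h : IsMeasureIso μ ν φ ψ) (h' : IsMeasureIso ν ρ φ' ψ') :
    IsMeasureIso μ ρ (φ' ∘ φ) (ψ ∘ ψ') where
  measurePreserving := h'.1.comp h.1
  measurePreserving_inv := h.2.comp h'.2
  left_inv := by
    filter_upwards [h.3, h.1.quasiMeasurePreserving.ae h'.3] with x hx hx'
    rw [Function.comp_apply, Function.comp_apply, hx', hx]
  right_inv := by
    filter_upwards [h'.4, h'.2.quasiMeasurePreserving.ae h.4] with x hx hx'
    rw [Function.comp_apply, Function.comp_apply, hx', hx]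

theorem smul_measure (h : IsMeasureIso μ ν φ ψ) (c : ENNReal) :
    IsMeasureIso (c • μ) (c • ν) φ ψ :=
  ⟨h.1.smul_measure c, h.2.smul_measure c, Measure.ae_smul_measure h.3 c,
    Measure.ae_smul_measure h.4 c⟩

end IsMeasureIso

theorem exists_isMeasureIso_map [Nonempty X] (μ : Measure X) {e : X → Y}
    (he : MeasurableEmbedding e) : ∃ ψ, IsMeasureIso μ (μ.map e) e ψ := by
  obtain ⟨g, hg, hge⟩ := he.exists_measurable_extend measurable_id fun _ => ‹Nonempty X›
  refine ⟨g, he.measurable.measurePreserving μ, ⟨hg, ?_⟩, Eventually.of_forall (congrFun hge), ?_⟩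
  · rw [Measure.map_map hg he.measurable, hge, Measure.map_id]
  · exact he.ae_map_iff.2 (Eventually.of_forall fun x => congrArg e (congrFun hge x))

theorem nullSingletonClass_map [NullSingletonClass μ] {e : X → Y} (he : MeasurableEmbedding e) :
    NullSingletonClass (μ.map e) where
  measure_singleton y := by
    rw [he.map_apply]
    exact (subsingleton_singleton.preimage he.injective).measure_zero μ

/-- The quantile function of a probability measure on `ℝ`, the generalized inverse of its
distribution function; only its values on `(0, 1)` are meaningful. -/
def quantile (α : Measure ℝ) (u : ℝ) : ℝ := sInf {x | u ≤ cdf α x}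

theorem quantile_le_iff (α : Measure ℝ) {u : ℝ} (hu : u ∈ Ioo 0 1) {x : ℝ} :
    quantile α u ≤ x ↔ u ≤ cdf α x := by
  have hbdd : BddBelow {x | u ≤ cdf α x} := by
    obtain ⟨a, ha⟩ := ((tendsto_cdf_atBot α).eventually_lt_const hu.1).exists
    exact ⟨a, fun x hx => ((monotone_cdf α).reflect_lt (ha.trans_le hx)).le⟩
  have hne : {x | u ≤ cdf α x}.Nonempty := by
    obtain ⟨b, hb⟩ := ((tendsto_cdf_atTop α).eventually_const_lt hu.2).exists
    exact ⟨b, hb.le⟩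
  refine ⟨fun hx => ?_, fun hx => csInf_le hbdd hx⟩
  have hright := ((cdf α).right_continuous x).tendsto.mono_left
    (nhdsWithin_mono x Ioi_subset_Ici_self)
  refine ge_of_tendsto hright ?_
  filter_upwards [self_mem_nhdsWithin] with y hy
  obtain ⟨z, hz, hzy⟩ := (csInf_lt_iff hbdd hne).1 (hx.trans_lt hy)
  exact le_trans hz (monotone_cdf α hzy.le)

theorem cdf_quantile (α : Measure ℝ) [IsProbabilityMeasure α] [NullSingletonClass α] {u : ℝ}
    (hu : u ∈ Ioo 0 1) : cdf α (quantile α u) = u := by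
  refine le_antisymm ?_ ((quantile_le_iff α hu).1 le_rfl)
  have hjump : Function.leftLim (cdf α) (quantile α u) = cdf α (quantile α u) := by
    have hatom := (cdf α).measure_singleton (quantile α u)
    rw [measure_cdf, measure_singleton, eq_comm, ENNReal.ofReal_eq_zero, sub_nonpos] at hatom
    exact ((monotone_cdf α).leftLim_le le_rfl).antisymm hatom
  have hleft := (monotone_cdf α).continuousWithinAt_Iio_iff_leftLim_eq.2 hjump
  refine le_of_tendsto hleft.tendsto ?_
  filter_upwards [self_mem_nhdsWithin] with y hy
  exact (not_le.1 fun h => hy.not_ge ((quantile_le_iff α hu).2 h)).le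

theorem aemeasurable_quantile (α : Measure ℝ) :
    AEMeasurable (quantile α) (volume.restrict (Ioo 0 1)) :=
  aemeasurable_restrict_of_monotoneOn measurableSet_Ioo fun _ hu _ hv huv =>
    (quantile_le_iff α hu).2 (huv.trans ((quantile_le_iff α hv).1 le_rfl))

theorem map_quantile (α : Measure ℝ) [IsProbabilityMeasure α] :
    (volume.restrict (Ioo 0 1)).map (quantile α) = α := by
  refine Measure.ext_of_Iic _ _ fun x => ?_
  have hpre : quantile α ⁻¹' Iic x =ᵐ[volume.restrict (Ioo 0 1)] Iic (cdf α x) := by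
    filter_upwards [ae_restrict_mem measurableSet_Ioo] with u hu
    exact propext (quantile_le_iff α hu)
  have hinter : Ioc (0 : ℝ) 1 ∩ Iic (cdf α x) = Ioc 0 (cdf α x) := by
    rw [Ioc_inter_Iic, min_eq_right (cdf_le_one α x)]
  rw [Measure.map_apply_of_aemeasurable (aemeasurable_quantile α) measurableSet_Iic,
    measure_congr hpre, restrict_Ioo_eq_restrict_Ioc, Measure.restrict_apply measurableSet_Iic,
    inter_comm, hinter, Real.volume_Ioc, sub_zero, ofReal_cdf]

theorem exists_isMeasureIso_cdf (α : Measure ℝ) [IsProbabilityMeasure α] [NullSingletonClass α] :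
    ∃ ψ, IsMeasureIso α (volume.restrict (Ioo 0 1)) (cdf α) ψ := by
  obtain ⟨ψ, hψ, hinv⟩ : ∃ ψ, MeasurePreserving ψ (volume.restrict (Ioo 0 1)) α ∧
      ∀ᵐ u ∂volume.restrict (Ioo 0 1), cdf α (ψ u) = u := by
    have hquantile := aemeasurable_quantile α
    refine ⟨hquantile.mk _, ⟨hquantile.measurable_mk, ?_⟩, ?_⟩
    · rw [← Measure.map_congr hquantile.ae_eq_mk, map_quantile]
    · filter_upwards [hquantile.ae_eq_mk, ae_restrict_mem measurableSet_Ioo] with u hu hu'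
      rw [← hu, cdf_quantile α hu']
  have hcdf : Measurable (cdf α) := (monotone_cdf α).measurable
  refine ⟨ψ, ⟨hcdf, ?_⟩, hψ, ?_, hinv⟩
  · calc
      α.map (cdf α) = ((volume.restrict (Ioo 0 1)).map ψ).map (cdf α) := by rw [hψ.map_eq]
      _ = volume.restrict (Ioo 0 1) := by
        rw [Measure.map_map hcdf hψ.measurable]
        exact (Measure.map_congr hinv).trans Measure.map_id
  · have hleft : ∀ᵐ x ∂(volume.restrict (Ioo 0 1)).map ψ, ψ (cdf α x) = x :=
      (ae_map_iff hψ.aemeasurable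
        (measurableSet_eq_fun (hψ.measurable.comp hcdf) measurable_id)).2
        (hinv.mono fun u hu => congrArg ψ hu)
    rwa [hψ.map_eq] at hleft

theorem exists_isMeasureIso_unitInterval [StandardBorelSpace X] (μ : Measure X)
    [IsProbabilityMeasure μ] [NullSingletonClass μ] :
    ∃ φ ψ, IsMeasureIso μ (volume.restrict (Ioo (0 : ℝ) 1)) φ ψ := by
  have := nonempty_of_isProbabilityMeasure μ
  have hembed := measurableEmbedding_embeddingReal X
  have := nullSingletonClass_map (μ := μ) hembed
  have := Measure.isProbabilityMeasure_map (μ := μ) hembed.measurable.aemeasurable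
  obtain ⟨ψ, hψ⟩ := exists_isMeasureIso_map μ hembed
  obtain ⟨ψ', hψ'⟩ := exists_isMeasureIso_cdf (μ.map (embeddingReal X))
  exact ⟨_, _, hψ.trans hψ'⟩

theorem exists_measureReal_eq_half [StandardBorelSpace X] (μ : Measure X)
    [IsProbabilityMeasure μ] [NullSingletonClass μ] :
    ∃ B, MeasurableSet B ∧ μ.real B = 1 / 2 := by
  obtain ⟨φ, ψ, h⟩ := exists_isMeasureIso_unitInterval μ
  refine ⟨φ ⁻¹' Ioo 0 (1 / 2), h.1.measurable measurableSet_Ioo, ?_⟩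
  rw [h.1.measureReal_preimage measurableSet_Ioo.nullMeasurableSet,
    measureReal_restrict_apply measurableSet_Ioo, Ioo_inter_Ioo, Real.volume_real_Ioo]
  norm_num

theorem exists_isMeasureIso_of_measure_univ_eq [StandardBorelSpace X] [StandardBorelSpace Y]
    [Nonempty X] [Nonempty Y] [IsFiniteMeasure μ] [IsFiniteMeasure ν] [NullSingletonClass μ]
    [NullSingletonClass ν] (h : μ univ = ν univ) : ∃ φ ψ, IsMeasureIso μ ν φ ψ := by
  rcases eq_or_ne μ 0 with hμ | hμ
  · obtain rfl : ν = 0 := Measure.measure_univ_eq_zero.1 (by rw [← h, hμ, Measure.coe_zero]; rfl)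
    obtain ⟨x⟩ := ‹Nonempty X›
    obtain ⟨y⟩ := ‹Nonempty Y›
    exact ⟨fun _ => y, fun _ => x, by subst hμ; exact
      ⟨⟨measurable_const, Measure.map_zero _⟩, ⟨measurable_const, Measure.map_zero _⟩,
        by simp, by simp⟩⟩
  have : NeZero μ := ⟨hμ⟩
  have : NeZero ν := ⟨fun hν => hμ (Measure.measure_univ_eq_zero.1 (by rw [h, hν]; rfl))⟩
  have : NullSingletonClass ((μ univ)⁻¹ • μ) := ⟨fun x => by simp⟩
  have : NullSingletonClass ((ν univ)⁻¹ • ν) := ⟨fun x => by simp⟩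
  obtain ⟨φ, ψ, hφ⟩ := exists_isMeasureIso_unitInterval ((μ univ)⁻¹ • μ)
  obtain ⟨φ', ψ', hφ'⟩ := exists_isMeasureIso_unitInterval ((ν univ)⁻¹ • ν)
  have hiso := (hφ.trans hφ'.symm).smul_measure (μ univ)
  rw [smul_smul, h, smul_smul, ENNReal.mul_inv_cancel (NeZero.ne _) (measure_ne_top _ _),
    one_smul, one_smul] at hiso
  exact ⟨_, _, hiso⟩

section Glue

variable {ι : Type*} [Countable ι] [MeasurableSpace ι] [MeasurableSingletonClass ι]
  {P : X → ι} {Q : Y → ι} {φ : ι → X → Y}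

theorem ae_of_forall_ae_restrict_fiber (hP : Measurable P) {p : ι → X → Prop}
    (h : ∀ a, ∀ᵐ x ∂μ.restrict (P ⁻¹' {a}), p a x) : ∀ᵐ x ∂μ, p (P x) x := by
  filter_upwards [ae_all_iff.2 fun a =>
    (ae_restrict_iff' (hP (measurableSet_singleton a))).1 (h a)] with x hx
  exact hx (P x) rfl

theorem sum_restrict_fiber (hP : Measurable P) (μ : Measure X) :
    Measure.sum (fun a => μ.restrict (P ⁻¹' {a})) = μ := by
  rw [← Measure.restrict_iUnion (fun a b hab => (disjoint_singleton.2 hab).preimage P)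
    fun a => hP (measurableSet_singleton a), ← preimage_iUnion, iUnion_of_singleton,
    preimage_univ, Measure.restrict_univ]

theorem measurePreserving_glue (hP : Measurable P) (hQ : Measurable Q)
    (hφ : ∀ a, MeasurePreserving (φ a) (μ.restrict (P ⁻¹' {a})) (ν.restrict (Q ⁻¹' {a}))) :
    MeasurePreserving (fun x => φ (P x) x) μ ν := by
  have hmeas : Measurable fun x => φ (P x) x :=
    (measurable_from_prod_countable_right fun a => (hφ a).measurable : Measurable
      fun q : ι × X => φ q.1 q.2).comp (hP.prodMk measurable_id)
  refine ⟨hmeas, ?_⟩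
  rw [← sum_restrict_fiber hP μ, Measure.map_sum hmeas.aemeasurable, ← sum_restrict_fiber hQ ν]
  congr 1
  funext a
  rw [← (hφ a).map_eq]
  refine Measure.map_congr ?_
  filter_upwards [ae_restrict_mem (hP (measurableSet_singleton a))] with x hx
  rw [hx]

theorem label_glue_ae_eq (hP : Measurable P) (hQ : Measurable Q)
    (hφ : ∀ a, MeasurePreserving (φ a) (μ.restrict (P ⁻¹' {a})) (ν.restrict (Q ⁻¹' {a}))) :
    ∀ᵐ x ∂μ, Q (φ (P x) x) = P x :=
  ae_of_forall_ae_restrict_fiber hP (p := fun a x => Q (φ a x) = a) fun a =>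
    (hφ a).quasiMeasurePreserving.ae (ae_restrict_mem (hQ (measurableSet_singleton a)))

theorem isMeasureIso_glue {ψ : ι → Y → X} (hP : Measurable P) (hQ : Measurable Q)
    (h : ∀ a, IsMeasureIso (μ.restrict (P ⁻¹' {a})) (ν.restrict (Q ⁻¹' {a})) (φ a) (ψ a)) :
    IsMeasureIso μ ν (fun x => φ (P x) x) (fun y => ψ (Q y) y) where
  measurePreserving := measurePreserving_glue hP hQ fun a => (h a).1
  measurePreserving_inv := measurePreserving_glue hQ hP fun a => (h a).2
  left_inv := by
    filter_upwards [label_glue_ae_eq hP hQ fun a => (h a).1,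
      ae_of_forall_ae_restrict_fiber hP fun a => (h a).3] with x hx hx'
    rw [hx, hx']
  right_inv := by
    filter_upwards [label_glue_ae_eq hQ hP fun a => (h a).2,
      ae_of_forall_ae_restrict_fiber hQ fun a => (h a).4] with y hy hy'
    rw [hy, hy']

theorem exists_isMeasureIso_label_ae_eq [StandardBorelSpace X] [StandardBorelSpace Y]
    [IsProbabilityMeasure μ] [IsProbabilityMeasure ν] [NullSingletonClass μ]
    [NullSingletonClass ν] (hP : Measurable P) (hQ : Measurable Q) (h : μ.map P = ν.map Q) :
    ∃ φ ψ, IsMeasureIso μ ν φ ψ ∧ ∀ᵐ x ∂μ, Q (φ x) = P x := by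
  have := nonempty_of_isProbabilityMeasure μ
  have := nonempty_of_isProbabilityMeasure ν
  have hfiber (a : ι) : ∃ φ ψ, IsMeasureIso (μ.restrict (P ⁻¹' {a})) (ν.restrict (Q ⁻¹' {a})) φ ψ :=
    exists_isMeasureIso_of_measure_univ_eq <| by
      rw [Measure.restrict_apply_univ, Measure.restrict_apply_univ,
        ← Measure.map_apply hP (measurableSet_singleton a), h,
        Measure.map_apply hQ (measurableSet_singleton a)]
  choose φ ψ hiso using hfiber
  exact ⟨_, _, isMeasureIso_glue hP hQ hiso, label_glue_ae_eq hP hQ fun a => (hiso a).1⟩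

end Glue

section PointwiseRealization

variable {s t : X → X}

theorem exists_invOn_of_isMeasureIso (h : IsMeasureIso μ μ s t) :
    ∃ Z : Set X, MeasurableSet Z ∧ (∀ᵐ x ∂μ, x ∈ Z) ∧ MapsTo s Z Z ∧ MapsTo t Z Z ∧
      InvOn t s Z Z := by
  obtain ⟨G, hGsub, hG, hG0⟩ := exists_measurable_superset_of_null (ae_iff.1 (h.3.and h.4))
  have hinv : ∀ x, x ∉ G → t (s x) = x ∧ s (t x) = x := fun x hx =>
    of_not_not fun hne => hx (hGsub hne)
  have hGae : ∀ᵐ x ∂μ, x ∉ G := measure_eq_zero_iff_ae_notMem.1 hG0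
  refine ⟨{x | ∀ n, s^[n] x ∉ G ∧ t^[n] x ∉ G}, ?_, ?_, fun x hx n => ?_, fun x hx n => ?_,
    fun x hx => (hinv x (hx 0).1).1, fun x hx => (hinv x (hx 0).1).2⟩
  · simp only [ofPred_forall, ofPred_and]
    exact .iInter fun n => (h.1.measurable.iterate n hG.compl).inter
      (h.2.measurable.iterate n hG.compl)
  · exact ae_all_iff.2 fun n => ((h.1.iterate n).quasiMeasurePreserving.ae hGae).and
      ((h.2.iterate n).quasiMeasurePreserving.ae hGae)
  · refine ⟨(hx (n + 1)).1, ?_⟩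
    cases n with
    | zero => exact (hx 1).1
    | succ n => rw [Function.iterate_succ_apply, (hinv x (hx 0).1).1]; exact (hx n).2
  · refine ⟨?_, (hx (n + 1)).2⟩
    cases n with
    | zero => exact (hx 1).2
    | succ n => rw [Function.iterate_succ_apply, (hinv x (hx 0).1).2]; exact (hx n).1

theorem exists_mpGroup_ae_eq (h : IsMeasureIso μ μ s t) :
    ∃ e : MPGroup μ, e.1 =ᵐ[μ] s ∧ e.1.symm =ᵐ[μ] t := by
  classical
  obtain ⟨Z, hZ, hZae, hsZ, htZ, hinv⟩ := exists_invOn_of_isMeasureIso h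
  let e : Equiv.Perm X :=
    { toFun := fun x => if x ∈ Z then s x else x
      invFun := fun x => if x ∈ Z then t x else x
      left_inv := fun x => by
        by_cases hx : x ∈ Z
        · simp [hx, hsZ hx, hinv.1 hx]
        · simp [hx]
      right_inv := fun x => by
        by_cases hx : x ∈ Z
        · simp [hx, htZ hx, hinv.2 hx]
        · simp [hx] }
  have hes : e =ᵐ[μ] s := hZae.mono fun x hx => if_pos hx
  have het : e.symm =ᵐ[μ] t := hZae.mono fun x hx => if_pos hx
  refine ⟨⟨e, ⟨.ite hZ h.1.measurable measurable_id, ?_⟩,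
    ⟨.ite hZ h.2.measurable measurable_id, ?_⟩⟩, hes, het⟩
  · rw [Measure.map_congr hes, h.1.map_eq]
  · rw [Measure.map_congr het, h.2.map_eq]

end PointwiseRealization

end MeasureIso

/-! ### Weak convergence and the Halmos metric -/

section WeakConvergence

open Set Topology

variable {X Y Z ι : Type*} [MeasurableSpace X] [MeasurableSpace Y] [MeasurableSpace Z]
  {μ : Measure X} {ν : Measure Y} {l : Filter ι}

/-- Weak convergence of the maps `f i` to `g` along `l`: the preimages of every measurable set
converge in measure. On `Aut(X, μ)` this is convergence in the Halmos metric. -/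
def TendstoWeakly (μ : Measure X) (f : ι → X → Y) (l : Filter ι) (g : X → Y) : Prop :=
  ∀ ⦃B : Set Y⦄, MeasurableSet B →
    Tendsto (fun i => μ.real (symmDiff (f i ⁻¹' B) (g ⁻¹' B))) l (𝓝 0)

theorem measureReal_symmDiff_preimage {f : X → Y} (hf : MeasurePreserving f μ ν) {B C : Set Y}
    (hB : MeasurableSet B) (hC : MeasurableSet C) :
    μ.real (symmDiff (f ⁻¹' B) (f ⁻¹' C)) = ν.real (symmDiff B C) := by
  rw [← preimage_symmDiff, hf.measureReal_preimage (hB.symmDiff hC).nullMeasurableSet]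

theorem TendstoWeakly.congr_right {f : ι → X → Y} {g g' : X → Y} (h : TendstoWeakly μ f l g)
    (hg : g =ᵐ[μ] g') : TendstoWeakly μ f l g' := fun B hB =>
  (h hB).congr fun _ => measureReal_congr ((ae_eq_refl _).symmDiff
    (hg.mono fun _ hx => congrArg (· ∈ B) hx))

theorem tendstoWeakly_const (f : X → Y) : TendstoWeakly μ (fun _ => f) l f := fun B _ => by
  simp only [symmDiff_self, bot_eq_empty, measureReal_empty, tendsto_const_nhds]

theorem TendstoWeakly.symm {s : ι → MPGroup μ} {t : MPGroup μ}
    (h : TendstoWeakly μ (fun i => (s i).1) l t.1) :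
    TendstoWeakly μ (fun i => (s i).1.symm) l t.1.symm := fun B hB => by
  have hC : MeasurableSet (t.1.symm ⁻¹' B) := t.2.2.measurable hB
  refine (h hC).congr fun i => ?_
  have hs := measureReal_symmDiff_preimage (s i).2.1 hC ((s i).2.2.measurable hB)
  rw [Equiv.preimage_symm_preimage] at hs
  rw [Equiv.preimage_symm_preimage, hs, symmDiff_comm]

variable [IsProbabilityMeasure μ]

theorem TendstoWeakly.comp {f : ι → X → Y} {f' : X → Y} {g : ι → Y → Z} {g' : Y → Z}
    (hg : TendstoWeakly ν g l g') (hf : TendstoWeakly μ f l f')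
    (hfm : ∀ i, MeasurePreserving (f i) μ ν) (hgm : ∀ i, Measurable (g i)) (hg'm : Measurable g') :
    TendstoWeakly μ (fun i => g i ∘ f i) l (g' ∘ f') := fun B hB => by
  refine squeeze_zero (fun _ => measureReal_nonneg) (fun i => ?_)
    (by simpa only [add_zero] using (hg hB).add (hf (hg'm hB)))
  refine (measureReal_symmDiff_triangle μ _ (f i ⁻¹' (g' ⁻¹' B)) _).trans_eq ?_
  rw [preimage_comp, measureReal_symmDiff_preimage (hfm i) (hgm i hB) (hg'm hB), preimage_comp]

theorem TendstoWeakly.iterate {f : ι → X → X} {g : X → X} (h : TendstoWeakly μ f l g)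
    (hf : ∀ i, MeasurePreserving (f i) μ μ) (hg : Measurable g) (n : ℕ) :
    TendstoWeakly μ (fun i => (f i)^[n]) l g^[n] := by
  induction n with
  | zero => exact tendstoWeakly_const id
  | succ n ih => exact ih.comp h hf (fun i => (hf i).measurable.iterate n) (hg.iterate n)

theorem TendstoWeakly.ae_eq [MeasurableSpace.CountablySeparated Y] [l.NeBot] {f : ι → X → Y}
    {g g' : X → Y} (h : TendstoWeakly μ f l g) (h' : TendstoWeakly μ f l g') : g =ᵐ[μ] g' := by
  refine EventuallyEq.of_forall_separating_preimage MeasurableSet fun B hB => ?_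
  rw [← measure_symmDiff_eq_zero_iff, ← measureReal_eq_zero_iff]
  refine le_antisymm ?_ measureReal_nonneg
  refine ge_of_tendsto (by simpa only [add_zero] using (h hB).add (h' hB)) (.of_forall fun i => ?_)
  rw [symmDiff_comm (f i ⁻¹' B) (g ⁻¹' B)]
  exact measureReal_symmDiff_triangle μ (g ⁻¹' B) (f i ⁻¹' B) (g' ⁻¹' B)

theorem tendsto_measureReal_symmDiff_of_ae_eventually [l.IsCountablyGenerated] {f : ι → X → Y}
    {g : X → Y} (hf : ∀ i, Measurable (f i)) (hg : Measurable g) {B : Set Y} (hB : MeasurableSet B)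
    (h : ∀ᵐ x ∂μ, ∀ᶠ i in l, (f i x ∈ B ↔ g x ∈ B)) :
    Tendsto (fun i => μ.real (symmDiff (f i ⁻¹' B) (g ⁻¹' B))) l (𝓝 0) := by
  have hlim := tendsto_measure_of_ae_tendsto_indicator_of_isFiniteMeasure (μ := μ) l
    MeasurableSet.empty (fun i => (hf i hB).symmDiff (hg hB)) <| by
      filter_upwards [h] with x hx
      filter_upwards [hx] with i hi
      simp only [mem_symmDiff, mem_preimage, hi, and_not_self, or_self, mem_empty_iff_false]
  rw [measure_empty] at hlim
  exact (ENNReal.tendsto_toReal ENNReal.zero_ne_top).comp hlim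

theorem TendstoWeakly.pi {τ α : Type*} [Finite τ] [Finite α] [MeasurableSpace α]
    [MeasurableSingletonClass α] {f : ι → X → τ → α} {g : X → τ → α}
    (h : ∀ t, TendstoWeakly μ (fun i x => f i x t) l fun x => g x t) : TendstoWeakly μ f l g := by
  cases nonempty_fintype τ
  cases nonempty_fintype α
  intro B _
  have hsum : Tendsto (fun i => ∑ p : τ × α, μ.real
      (symmDiff ((fun x => f i x p.1) ⁻¹' {p.2}) ((fun x => g x p.1) ⁻¹' {p.2}))) l (𝓝 0) := by
    simpa only [Finset.sum_const_zero] using tendsto_finsetSum Finset.univ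
      fun (p : τ × α) _ => h p.1 (measurableSet_singleton p.2)
  refine squeeze_zero (fun _ => measureReal_nonneg) (fun i => ?_) hsum
  refine (measureReal_mono fun x hx => ?_).trans (measureReal_iUnion_fintype_le _)
  have hne : f i x ≠ g x := fun heq => by
    simp only [mem_symmDiff, mem_preimage, heq, and_not_self, or_self] at hx
  obtain ⟨t, ht⟩ := Function.ne_iff.1 hne
  exact mem_iUnion.2 ⟨(t, f i x t), Or.inl ⟨rfl, Ne.symm ht⟩⟩

theorem TendstoWeakly.tendsto_partitionEntropy {α : Type*} [Fintype α] [MeasurableSpace α]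
    [MeasurableSingletonClass α] {f : ι → X → α} {g : X → α} (h : TendstoWeakly μ f l g)
    (hf : ∀ i, Measurable (f i)) (hg : Measurable g) :
    Tendsto (fun i => partitionEntropy μ (f i)) l (𝓝 (partitionEntropy μ g)) := by
  refine tendsto_finsetSum _ fun a _ => (Real.continuous_negMulLog.tendsto _).comp ?_
  have ha := measurableSet_singleton a
  refine tendsto_iff_dist_tendsto_zero.2 (squeeze_zero (fun _ => dist_nonneg) (fun i => ?_) (h ha))
  exact abs_measureReal_sub_le_measureReal_symmDiff (hf i ha).nullMeasurableSet
    (hg ha).nullMeasurableSet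

section DenseFamily

variable (A : DenseFamily μ)

theorem tendsto_measureReal_symmDiff_of_denseFamily {f g : ι → X → X}
    (hf : ∀ i, MeasurePreserving (f i) μ μ) (hg : ∀ i, MeasurePreserving (g i) μ μ)
    (h : ∀ k, Tendsto (fun i => μ.real (symmDiff (f i ⁻¹' A.set k) (g i ⁻¹' A.set k))) l (𝓝 0))
    {B : Set X} (hB : MeasurableSet B) :
    Tendsto (fun i => μ.real (symmDiff (f i ⁻¹' B) (g i ⁻¹' B))) l (𝓝 0) := by
  refine tendsto_order.2 ⟨fun a ha => .of_forall fun i => ha.trans_le measureReal_nonneg,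
    fun ε hε => ?_⟩
  obtain ⟨k, hk⟩ := A.dense B hB (ε / 4) (by positivity)
  filter_upwards [(h k).eventually_lt_const (by positivity : (0 : ℝ) < ε / 4)] with i hi
  have hfB := measureReal_symmDiff_preimage (hf i) hB (A.measurableSet k)
  have hgB := measureReal_symmDiff_preimage (hg i) (A.measurableSet k) hB
  rw [symmDiff_comm B] at hfB
  linarith [measureReal_symmDiff_triangle μ (f i ⁻¹' B) (f i ⁻¹' A.set k) (g i ⁻¹' B),
    measureReal_symmDiff_triangle μ (f i ⁻¹' A.set k) (g i ⁻¹' A.set k) (g i ⁻¹' B)]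

theorem tendsto_measureReal_symmDiff_of_tendsto_preDist {s t : ι → MPGroup μ}
    (h : Tendsto (fun i => preDist A (s i) (t i)) l (𝓝 0)) {B : Set X} (hB : MeasurableSet B) :
    Tendsto (fun i => μ.real (symmDiff ((s i).1 ⁻¹' B) ((t i).1 ⁻¹' B))) l (𝓝 0) := by
  refine tendsto_measureReal_symmDiff_of_denseFamily A (fun i => (s i).2.1) (fun i => (t i).2.1)
    (fun k => ?_) hB
  refine squeeze_zero (fun _ => measureReal_nonneg) (fun i => ?_)
    (by simpa only [mul_zero] using h.const_mul (2 ^ k))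
  have hterm : (1 / 2 : ℝ) ^ k * setDist μ (A.set k) (s i) (t i) ≤ preDist A (s i) (t i) :=
    (summable_preDist A (s i) (t i)).le_tsum k
      fun m _ => mul_nonneg (by positivity) (setDist_nonneg μ (A.set m) (s i) (t i))
  rw [one_div, inv_pow, inv_mul_le_iff₀ (by positivity)] at hterm
  refine le_trans ?_ hterm
  rw [setDist, Equiv.image_symm_eq_preimage, Equiv.image_symm_eq_preimage]
  exact le_add_of_nonneg_left measureReal_nonneg

theorem tendsto_preDist_of_tendstoWeakly {s : ι → MPGroup μ} {t : MPGroup μ}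
    (h : TendstoWeakly μ (fun i => (s i).1) l t.1) :
    Tendsto (fun i => preDist A (s i) t) l (𝓝 0) := by
  have hset (k : ℕ) : Tendsto (fun i => setDist μ (A.set k) (s i) t) l (𝓝 0) := by
    simp only [setDist, Equiv.image_eq_preimage_symm, Equiv.symm_symm]
    simpa only [add_zero] using (h.symm (A.measurableSet k)).add (h (A.measurableSet k))
  have hdom := tendsto_tsum_of_dominated_convergence (𝓕 := l) (g := fun _ => (0 : ℝ))
    (f := fun i (k : ℕ) => (1 / 2 : ℝ) ^ k * setDist μ (A.set k) (s i) t)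
    (bound := fun k : ℕ => (1 / 2 : ℝ) ^ k * 2) (summable_geometric_two.mul_right 2)
    (fun k => by simpa only [mul_zero] using (hset k).const_mul ((1 / 2 : ℝ) ^ k))
    (.of_forall fun i k => by
      rw [Real.norm_of_nonneg (mul_nonneg (by positivity) (setDist_nonneg _ _ _ _))]
      gcongr
      exact (add_le_add measureReal_le_one measureReal_le_one).trans_eq one_add_one_eq_two)
  rwa [tsum_zero] at hdom

variable [StandardBorelSpace X]

theorem tendsto_nhds_halmos_iff {s : ι → MPGroup μ} {t : MPGroup μ} :
    letI := halmosMetricSpace A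
    Tendsto (fun i => (s i : Aut μ)) l (𝓝 (t : Aut μ)) ↔
      TendstoWeakly μ (fun i => (s i).1) l t.1 := by
  let := halmosMetricSpace A
  exact tendsto_iff_dist_tendsto_zero.trans
    ⟨fun h _ hB => tendsto_measureReal_symmDiff_of_tendsto_preDist A (t := fun _ => t) h hB,
      tendsto_preDist_of_tendstoWeakly A⟩

theorem continuous_itineraryEntropy_pow {k : ℕ} {ξ : X → Fin k} (hξ : Measurable ξ) (n j : ℕ) :
    letI := halmosMetricSpace A
    Continuous fun S : Aut μ => itineraryEntropy ξ n (S ^ j) := by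
  let := halmosMetricSpace A
  refine continuous_iff_continuousAt.2 fun T => ?_
  rcases T with ⟨t⟩
  have hout : TendstoWeakly μ (fun S : Aut μ => S.out.1) (𝓝 (t : Aut μ)) t.1 :=
    (tendsto_nhds_halmos_iff A).1 <| tendsto_id.congr fun S => (Quotient.out_eq S).symm
  have hitinerary : TendstoWeakly μ (fun S : Aut μ => itinerary (S.out.1)^[j] ξ n) (𝓝 (t : Aut μ))
      (itinerary t.1^[j] ξ n) := by
    refine .pi fun i => ?_
    have hiterate := (hout.iterate (fun S => S.out.2.1) t.2.1.measurable j).iterate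
      (fun S => S.out.2.1.iterate j) (t.2.1.measurable.iterate j) i
    exact (tendstoWeakly_const ξ).comp hiterate (fun S => (S.out.2.1.iterate j).iterate i)
      (fun _ => hξ) hξ
  have hlim := hitinerary.tendsto_partitionEntropy
    (fun S => measurable_itinerary (S.out.2.1.measurable.iterate j) hξ n)
    (measurable_itinerary (t.2.1.measurable.iterate j) hξ n)
  simp only [← coe_pow_eq_iterate] at hlim
  exact hlim.congr fun S => congrArg (fun T => itineraryEntropy ξ n (T ^ j)) (Quotient.out_eq S)

end DenseFamily

end WeakConvergence

/-! ### Completeness of the Halmos metric -/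

section Completeness

open Set Topology

variable {X Y : Type*} [MeasurableSpace X] [MeasurableSpace Y] {μ : Measure X} {ν : Measure Y}

theorem ae_eventuallyConst_mem_of_summable [IsFiniteMeasure μ] {E : ℕ → Set X}
    (h : Summable fun n => μ.real (symmDiff (E n) (E (n + 1)))) :
    ∀ᵐ x ∂μ, EventuallyConst (fun n => x ∈ E n) atTop := by
  have htsum : ∑' n, μ (symmDiff (E n) (E (n + 1))) ≠ ⊤ := by
    convert h.tsum_ofReal_ne_top with n
    exact (ofReal_measureReal).symm
  filter_upwards [ae_eventually_notMem htsum] with x hx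
  obtain ⟨N, hN⟩ := eventually_atTop.1 hx
  refine eventuallyConst_atTop_nat.2 ⟨N, fun n hn => propext ?_⟩
  have := hN n hn
  rw [mem_symmDiff] at this
  tauto

theorem exists_measurePreserving_ae_tendsto [Nonempty Y] [IsProbabilityMeasure μ]
    [IsProbabilityMeasure ν] {E : Type*} [TopologicalSpace E] [TopologicalSpace.MetrizableSpace E]
    [MeasurableSpace E] [BorelSpace E] {c : Y → E} (hc : MeasurableEmbedding c) {f : ℕ → X → Y}
    (hf : ∀ n, MeasurePreserving (f n) μ ν)
    (h : ∀ᵐ x ∂μ, ∃ y, Tendsto (fun n => c (f n x)) atTop (𝓝 y)) :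
    ∃ t, MeasurePreserving t μ ν ∧
      ∀ᵐ x ∂μ, Tendsto (fun n => c (f n x)) atTop (𝓝 (c (t x))) := by
  have hcf (n : ℕ) : MeasurePreserving (c ∘ f n) μ (ν.map c) :=
    (hc.measurable.measurePreserving ν).comp (hf n)
  obtain ⟨g, hg, hlim⟩ := measurable_limit_of_tendsto_metrizable_ae
    (fun n => (hcf n).aemeasurable) h
  have hlaw : μ.map g = ν.map c := tendstoInDistribution_unique (fun n => c ∘ f n)
    (tendstoInDistribution_of_ae_tendsto (fun n => (hcf n).aemeasurable) hg.aemeasurable hlim)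
    (tendstoInDistribution_of_identDistrib 0
      (fun n => ⟨(hcf 0).aemeasurable, (hcf n).aemeasurable,
        by rw [(hcf 0).map_eq, (hcf n).map_eq]⟩)
      ⟨(hcf 0).aemeasurable, hc.measurable.aemeasurable, (hcf 0).map_eq⟩)
  have hgm : MeasurePreserving g μ (ν.map c) := ⟨hg, hlaw⟩
  obtain ⟨ψ, hψ⟩ := exists_isMeasureIso_map ν hc
  refine ⟨ψ ∘ g, hψ.2.comp hgm, ?_⟩
  filter_upwards [hlim, hgm.quasiMeasurePreserving.ae hψ.4] with x hx hx'
  rwa [Function.comp_apply, hx']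

theorem exists_measurePreserving_ae_eventually_mem_iff [StandardBorelSpace Y]
    [IsProbabilityMeasure μ] [IsProbabilityMeasure ν] {D : ℕ → Set Y}
    (hD : ∀ k, MeasurableSet (D k)) (hsep : ∀ x y, (∀ k, x ∈ D k ↔ y ∈ D k) → x = y)
    {f : ℕ → X → Y} (hf : ∀ n, MeasurePreserving (f n) μ ν)
    (h : ∀ k, Summable fun n => μ.real (symmDiff (f n ⁻¹' D k) (f (n + 1) ⁻¹' D k))) :
    ∃ t, MeasurePreserving t μ ν ∧ ∀ k, ∀ᵐ x ∂μ, ∀ᶠ n in atTop, (f n x ∈ D k ↔ t x ∈ D k) := by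
  have := nonempty_of_isProbabilityMeasure ν
  have hmem (k : ℕ) (y z : Y) : (D k).boolIndicator y = (D k).boolIndicator z ↔
      (y ∈ D k ↔ z ∈ D k) := by
    rw [mem_iff_boolIndicator, mem_iff_boolIndicator, Bool.eq_iff_iff]
  have hcode : MeasurableEmbedding fun y k => (D k).boolIndicator y :=
    (measurable_pi_lambda _ fun k => measurable_to_bool <| by
      simpa only [preimage_boolIndicator_true] using hD k).measurableEmbedding
      fun y z hyz => hsep y z fun k => (hmem k y z).1 (congrFun hyz k)
  obtain ⟨t, ht, hlim⟩ := exists_measurePreserving_ae_tendsto hcode hf <| by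
    filter_upwards [ae_all_iff.2 fun k => ae_eventuallyConst_mem_of_summable (h k)] with x hx
    choose b hb using fun k => eventuallyConst_iff_exists_eventuallyEq.1
      ((hx k).comp fun p => @decide p (Classical.dec p))
    exact ⟨b, tendsto_pi_nhds.2 fun k => tendsto_nhds_of_eventually_eq (hb k)⟩
  refine ⟨t, ht, fun k => hlim.mono fun x hx => ?_⟩
  have hk := tendsto_pi_nhds.1 hx k
  rw [nhds_discrete, tendsto_pure] at hk
  exact hk.mono fun n hn => (hmem k _ _).1 hn

theorem exists_separating_sequence (A : DenseFamily μ)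
    [MeasurableSpace.CountablySeparated X] :
    ∃ D : ℕ → Set X, (∀ k, MeasurableSet (D k)) ∧ (∀ x y, (∀ k, x ∈ D k ↔ y ∈ D k) → x = y) ∧
      range A.set ⊆ range D := by
  obtain ⟨S, hS, hsep⟩ := exists_seq_separating X MeasurableSet.empty univ
  obtain ⟨D, hD⟩ := ((countable_range S).union (countable_range A.set)).exists_eq_range
    ((range_nonempty S).inl)
  refine ⟨D, fun k => ?_, fun x y hxy => hsep x (mem_univ x) y (mem_univ y) fun n => ?_,
    hD ▸ subset_union_right⟩
  · obtain ⟨n, hn⟩ | ⟨n, hn⟩ := hD.symm ▸ mem_range_self k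
    · exact hn ▸ hS n
    · exact hn ▸ A.measurableSet n
  · obtain ⟨k, hk⟩ : S n ∈ range D := hD ▸ Or.inl (mem_range_self n)
    exact hk ▸ hxy k

variable [IsProbabilityMeasure μ]

theorem exists_mpGroup_tendstoWeakly [StandardBorelSpace X] {s : ℕ → MPGroup μ} {t r : X → X}
    (ht : MeasurePreserving t μ μ) (hr : MeasurePreserving r μ μ)
    (hst : TendstoWeakly μ (fun n => (s n).1) atTop t)
    (hsr : TendstoWeakly μ (fun n => (s n).1.symm) atTop r) :
    ∃ e : MPGroup μ, TendstoWeakly μ (fun n => (s n).1) atTop e.1 := by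
  have hrt := hsr.comp hst (fun n => (s n).2.1) (fun n => (s n).2.2.measurable) hr.measurable
  have htr := hst.comp hsr (fun n => (s n).2.2) (fun n => (s n).2.1.measurable) ht.measurable
  simp only [Equiv.symm_comp_self] at hrt
  simp only [Equiv.self_comp_symm] at htr
  obtain ⟨e, he, -⟩ := exists_mpGroup_ae_eq
    ⟨ht, hr, hrt.ae_eq (tendstoWeakly_const id), htr.ae_eq (tendstoWeakly_const id)⟩
  exact ⟨e, hst.congr_right he.symm⟩

variable (A : DenseFamily μ)

theorem exists_tendstoWeakly_of_summable [StandardBorelSpace X] {D : ℕ → Set X}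
    (hD : ∀ k, MeasurableSet (D k)) (hsep : ∀ x y, (∀ k, x ∈ D k ↔ y ∈ D k) → x = y)
    (hDA : range A.set ⊆ range D) {f : ℕ → X → X} (hf : ∀ n, MeasurePreserving (f n) μ μ)
    (h : ∀ k, Summable fun n => μ.real (symmDiff (f n ⁻¹' D k) (f (n + 1) ⁻¹' D k))) :
    ∃ t, MeasurePreserving t μ μ ∧ TendstoWeakly μ f atTop t := by
  obtain ⟨t, ht, hlim⟩ := exists_measurePreserving_ae_eventually_mem_iff hD hsep hf h
  refine ⟨t, ht, fun B hB => tendsto_measureReal_symmDiff_of_denseFamily A hf (fun _ => ht)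
    (fun i => ?_) hB⟩
  obtain ⟨k, hk⟩ := hDA (mem_range_self i)
  rw [← hk]
  exact tendsto_measureReal_symmDiff_of_ae_eventually (fun n => (hf n).measurable) ht.measurable
    (hD k) (hlim k)

variable [StandardBorelSpace X]

theorem eventually_uniformity_measureReal_lt {B : Set X} (hB : MeasurableSet B) {ε : ℝ}
    (hε : 0 < ε) :
    letI := halmosMetricSpace A
    ∀ᶠ p : Aut μ × Aut μ in uniformity (Aut μ),
      μ.real (symmDiff (p.1.out.1 ⁻¹' B) (p.2.out.1 ⁻¹' B)) < ε ∧
        μ.real (symmDiff (p.1.out.1.symm ⁻¹' B) (p.2.out.1.symm ⁻¹' B)) < ε := by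
  let := halmosMetricSpace A
  have hdist : Tendsto (fun p : Aut μ × Aut μ => preDist A p.1.out p.2.out)
      (uniformity (Aut μ)) (𝓝 0) := by
    rw [Metric.uniformity_eq_comap_nhds_zero]
    refine tendsto_comap.congr fun p => ?_
    conv_lhs => rw [← Quotient.out_eq p.1, ← Quotient.out_eq p.2]
    rfl
  have hdist_inv : Tendsto (fun p : Aut μ × Aut μ => preDist A p.1.out⁻¹ p.2.out⁻¹)
      (uniformity (Aut μ)) (𝓝 0) :=
    hdist.congr fun p => tsum_congr fun k => congrArg _ (add_comm _ _)
  exact ((tendsto_measureReal_symmDiff_of_tendsto_preDist A hdist hB).eventually_lt_const hε).and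
    ((tendsto_measureReal_symmDiff_of_tendsto_preDist A hdist_inv hB).eventually_lt_const hε)

theorem completeSpace_halmos : letI := halmosMetricSpace A; CompleteSpace (Aut μ) := by
  let := halmosMetricSpace A
  obtain ⟨D, hD, hsep, hDA⟩ := exists_separating_sequence A
  refine UniformSpace.complete_of_convergent_controlled_sequences
    (fun N => {p : Aut μ × Aut μ | ∀ k ∈ Iic N,
      μ.real (symmDiff (p.1.out.1 ⁻¹' D k) (p.2.out.1 ⁻¹' D k)) < (1 / 2) ^ N ∧
        μ.real (symmDiff (p.1.out.1.symm ⁻¹' D k) (p.2.out.1.symm ⁻¹' D k)) < (1 / 2) ^ N})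
    (fun N => (eventually_all_finite (finite_Iic N)).2 fun k _ =>
      eventually_uniformity_measureReal_lt A (hD k) (by positivity)) fun u hu => ?_
  have hctl (k n : ℕ) (hkn : n ≥ k) := hu n n (n + 1) le_rfl n.le_succ k hkn
  have hsummable {E : ℕ → ℕ → Set X}
      (hE : ∀ k, ∀ n ≥ k, μ.real (symmDiff (E k n) (E k (n + 1))) < (1 / 2) ^ n) (k : ℕ) :
      Summable fun n => μ.real (symmDiff (E k n) (E k (n + 1))) := by
    refine summable_geometric_two.of_norm_bounded_eventually_nat ?_
    filter_upwards [eventually_ge_atTop k] with n hn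
    rw [Real.norm_of_nonneg measureReal_nonneg]
    exact (hE k n hn).le
  obtain ⟨t, ht, hut⟩ := exists_tendstoWeakly_of_summable A hD hsep hDA
    (fun n => (u n).out.2.1) (hsummable fun k n hkn => (hctl k n hkn).1)
  obtain ⟨r, hr, hur⟩ := exists_tendstoWeakly_of_summable A hD hsep hDA
    (fun n => (u n).out.2.2) (hsummable fun k n hkn => (hctl k n hkn).2)
  obtain ⟨e, he⟩ := exists_mpGroup_tendstoWeakly ht hr hut hur
  exact ⟨e, ((tendsto_nhds_halmos_iff A).2 he).congr fun n => Quotient.out_eq (u n)⟩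

end Completeness

/-! ### Uniform decay of the entropy on a compact set -/

section Compactness

variable {X : Type*} [MeasurableSpace X] {μ : Measure X} [IsProbabilityMeasure μ]

theorem eventually_itineraryEntropy_pow_le_of_denseFamily (A : DenseFamily μ)
    {S : Aut μ} {L : ℕ → ℕ}
    (hS : ∀ j, ∀ m < j,
      itineraryEntropy (twoSetLabel (A.set m)) (L j) (S ^ (j + 1)) ≤ L j * (1 / ((j : ℝ) + 1)))
    {C : Set X} (hC : MeasurableSet C) {ε : ℝ} (hε : 0 < ε) :
    ∀ᶠ j in atTop, itineraryEntropy (twoSetLabel C) (L j) (S ^ (j + 1)) ≤ L j * ε := by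
  have hbin : ∀ᶠ x in nhds (0 : ℝ), Real.binEntropy x < ε / 2 :=
    Real.binEntropy_continuous.continuousAt.eventually_lt_const
      (Real.binEntropy_zero.trans_lt (half_pos hε))
  obtain ⟨δ, hδ, hδ'⟩ := Metric.eventually_nhds_iff.1 hbin
  obtain ⟨m, hm⟩ := A.dense C hC δ hδ
  have hsmall : Real.binEntropy (μ.real (symmDiff (A.set m) C)) < ε / 2 := hδ' <| by
    rwa [Real.dist_eq, sub_zero, abs_of_nonneg measureReal_nonneg]
  filter_upwards [eventually_gt_atTop m,
    tendsto_one_div_add_atTop_nhds_zero_nat.eventually_lt_const (half_pos hε)] with j hj hj'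
  calc itineraryEntropy (twoSetLabel C) (L j) (S ^ (j + 1))
      ≤ itineraryEntropy (twoSetLabel (A.set m)) (L j) (S ^ (j + 1)) +
          L j * Real.binEntropy (μ.real (symmDiff (A.set m) C)) :=
        itineraryEntropy_twoSetLabel_le hC (A.measurableSet m) _ _
    _ ≤ L j * (ε / 2) + L j * (ε / 2) := by
        gcongr
        exact (hS j m hj).trans (by gcongr)
    _ = L j * ε := by ring

variable [StandardBorelSpace X]

theorem exists_nhds_itineraryEntropy_pow_le (A : DenseFamily μ) {S : Aut μ}
    (hS : ksEntropy S = 0) (M : ℕ) {j : ℕ} (hj : 0 < j) {ε : ℝ} (hε : 0 < ε) :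
    letI := halmosMetricSpace A
    ∃ U ∈ nhds S, ∃ n > 0, ∀ T ∈ U, ∀ m < M,
      itineraryEntropy (twoSetLabel (A.set m)) n (T ^ j) ≤ n * ε := by
  let := halmosMetricSpace A
  have hlabel (m : ℕ) : Measurable (twoSetLabel (A.set m)) :=
    measurable_twoSetLabel (A.measurableSet m)
  have hlt : ∀ᶠ n : ℕ in atTop, ∀ m ∈ Set.Iio M,
      itineraryEntropy (twoSetLabel (A.set m)) n (S ^ j) < n * ε :=
    (eventually_all_finite (Set.finite_Iio M)).2 fun m _ =>
      eventually_itineraryEntropy_pow_lt hS (hlabel m) hj hε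
  obtain ⟨n, hn, hn0⟩ := (hlt.and (eventually_gt_atTop 0)).exists
  have hnhds : ∀ᶠ T in nhds S, ∀ m ∈ Set.Iio M,
      itineraryEntropy (twoSetLabel (A.set m)) n (T ^ j) < n * ε :=
    (eventually_all_finite (Set.finite_Iio M)).2 fun m hm =>
      (continuous_itineraryEntropy_pow A (hlabel m) n j).continuousAt.eventually_lt_const (hn m hm)
  exact ⟨_, hnhds, n, hn0, fun T hT m hm => (hT m hm).le⟩

theorem exists_uniform_itinerary_length (A : DenseFamily μ) {K : Set (Aut μ)} :
    letI := halmosMetricSpace A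
    IsCompact K → (∀ S ∈ K, ksEntropy S = 0) → ∀ (M : ℕ) {j : ℕ}, 0 < j → ∀ {ε : ℝ}, 0 < ε →
      ∃ n > 0, ∀ S ∈ K, ∀ m < M,
        itineraryEntropy (twoSetLabel (A.set m)) n (S ^ j) ≤ n * ε := by
  let := halmosMetricSpace A
  intro hK hK0 M j hj ε hε
  have hmul {S : Aut μ} {m n : ℕ} (l : ℕ)
      (h : itineraryEntropy (twoSetLabel (A.set m)) n (S ^ j) ≤ n * ε) :
      itineraryEntropy (twoSetLabel (A.set m)) (l * n) (S ^ j) ≤ (l * n : ℕ) * ε := by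
    refine (itineraryEntropy_mul_le (measurable_twoSetLabel (A.measurableSet m)) l n _).trans ?_
    rw [Nat.cast_mul, mul_assoc]
    exact mul_le_mul_of_nonneg_left h (Nat.cast_nonneg l)
  refine hK.induction_on (p := fun s => ∃ n > 0, ∀ S ∈ s, ∀ m < M,
    itineraryEntropy (twoSetLabel (A.set m)) n (S ^ j) ≤ n * ε) ?_ ?_ ?_ ?_
  · exact ⟨1, one_pos, fun S hS => absurd hS (Set.notMem_empty S)⟩
  · rintro s t hst ⟨n, hn, h⟩
    exact ⟨n, hn, fun S hS => h S (hst hS)⟩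
  · rintro s t ⟨n, hn, h⟩ ⟨n', hn', h'⟩
    refine ⟨n' * n, Nat.mul_pos hn' hn, fun S hS m hm => hS.elim (fun hS => ?_) fun hS => ?_⟩
    · exact hmul n' (h S hS m hm)
    · exact Nat.mul_comm n n' ▸ hmul n (h' S hS m hm)
  · intro S hS
    obtain ⟨U, hU, h⟩ := exists_nhds_itineraryEntropy_pow_le A (hK0 S hS) M hj hε
    exact ⟨U, mem_nhdsWithin_of_mem_nhds hU, h⟩

end Compactness

/-! ### Independence along an arithmetic progression -/

section Modelling

variable {X Z ι : Type*} [MeasurableSpace X] [MeasurableSpace Z] [StandardBorelSpace X]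
  [StandardBorelSpace Z] {μ : Measure X} {ν : Measure Z} [IsProbabilityMeasure μ]
  [IsProbabilityMeasure ν] [NullSingletonClass μ] [NullSingletonClass ν]
  [Countable ι] [MeasurableSpace ι] [MeasurableSingletonClass ι]

theorem exists_mpGroup_pow_label_ae_eq (f : MPGroup ν) {P : X → ι} {Q : Z → ι}
    (hP : Measurable P) (hQ : Measurable Q) (h : μ.map P = ν.map Q) :
    ∃ e : MPGroup μ, ∃ φ : X → Z, MeasurePreserving φ μ ν ∧
      ∀ᵐ x ∂μ, ∀ n : ℕ, P ((e ^ n).1 x) = Q ((f ^ n).1 (φ x)) := by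
  obtain ⟨φ, ψ, hφ, hlabel⟩ := exists_isMeasureIso_label_ae_eq hP hQ h
  have hf : IsMeasureIso ν ν f.1 f.1.symm :=
    ⟨f.2.1, f.2.2, .of_forall f.1.symm_apply_apply, .of_forall f.1.apply_symm_apply⟩
  obtain ⟨e, he, -⟩ := exists_mpGroup_ae_eq ((hφ.trans hf).trans hφ.symm)
  have hstep : ∀ᵐ x ∂μ, φ (e.1 x) = f.1 (φ x) := by
    filter_upwards [he, (hf.1.comp hφ.1).quasiMeasurePreserving.ae hφ.4] with x hx hx'
    rw [hx]
    exact hx'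
  have hiterate (n : ℕ) : ∀ᵐ x ∂μ, φ ((e ^ n).1 x) = (f ^ n).1 (φ x) := by
    induction n with
    | zero => exact .of_forall fun _ => rfl
    | succ n ih =>
      filter_upwards [ih, (e ^ n).2.1.quasiMeasurePreserving.ae hstep] with x hx hx'
      rw [pow_succ' e, pow_succ' f]
      exact hx'.trans (congrArg f.1 hx)
  refine ⟨e, φ, hφ.1, ae_all_iff.2 fun n => ?_⟩
  filter_upwards [hiterate n, (e ^ n).2.1.quasiMeasurePreserving.ae hlabel] with x hx hx'
  rw [← hx, hx']

end Modelling

section CoordinateActions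

variable {X κ : Type*} [MeasurableSpace X] [Fintype κ] {μ : Measure X} [SigmaFinite μ]

/-- The diagonal action of `Aut(X, μ)` on the power `X ^ κ`. -/
def diagonalAction (κ : Type*) [Fintype κ] :
    MPGroup μ →* MPGroup (Measure.pi fun _ : κ => μ) where
  toFun s := ⟨Equiv.piCongrRight fun _ => s.1,
    measurePreserving_pi _ _ fun _ => s.2.1, measurePreserving_pi _ _ fun _ => s.2.2⟩
  map_one' := rfl
  map_mul' _ _ := rfl

/-- The action of the permutations of `κ` on the power `X ^ κ`. -/
def coordinatePermutation (μ : Measure X) [SigmaFinite μ] :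
    Equiv.Perm κ →* MPGroup (Measure.pi fun _ : κ => μ) where
  toFun σ := ⟨σ.arrowCongr (Equiv.refl X),
    measurePreserving_arrowCongr' (fun _ => μ) (fun _ => μ) σ (.refl X) fun _ => .id μ,
    measurePreserving_arrowCongr' (fun _ => μ) (fun _ => μ) σ.symm (.refl X) fun _ => .id μ⟩
  map_one' := rfl
  map_mul' _ _ := rfl

theorem commute_diagonalAction_coordinatePermutation (s : MPGroup μ) (σ : Equiv.Perm κ) :
    Commute (diagonalAction κ s) (coordinatePermutation μ σ) := rfl

end CoordinateActions

section Clock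

open ProbabilityTheory

variable {C Z : Type*} [MeasurableSpace Z] {ν : Measure Z} [SFinite ν]

theorem prodShear_mem_mpGroup [MeasurableSpace C] [Countable C] [MeasurableSingletonClass C]
    {m : Measure C} [SFinite m] (e : MPGroup m) (g : C → MPGroup ν) :
    e.1.prodShear (fun c => (g c).1) ∈ MPGroup (m.prod ν) :=
  ⟨e.2.1.skew_product (measurable_from_prod_countable_right fun c => (g c).2.1.measurable)
      (.of_forall fun c => (g c).2.1.map_eq),
    e.2.2.skew_product (g := fun c => (g (e.1.symm c)).1.symm)
      (measurable_from_prod_countable_right fun c => (g (e.1.symm c)).2.2.measurable)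
      (.of_forall fun c => (g (e.1.symm c)).2.2.map_eq)⟩

theorem measurePreserving_uniformOn_univ [Finite C] [MeasurableSpace C]
    [MeasurableSingletonClass C] (e : Equiv.Perm C) :
    MeasurePreserving e (uniformOn (.univ : Set C)) (uniformOn .univ) := by
  cases nonempty_fintype C
  refine ⟨measurable_of_countable e, Measure.ext_iff_singleton.2 fun c => ?_⟩
  rw [Measure.map_apply (measurable_of_countable e) (measurableSet_singleton c),
    ← Equiv.image_symm_eq_preimage, Set.image_singleton]
  simp only [uniformOn_univ, Measure.count_singleton]

variable (q : ℕ) [NeZero q]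

/-- The skew product over the cyclic clock `c ↦ c + 1` on `Fin q` that acts on the fibre by `s`,
after an application of `r` when the clock shows `0`. -/
def clockShift (s r : MPGroup ν) : MPGroup ((uniformOn (.univ : Set (Fin q))).prod ν) :=
  ⟨_, prodShear_mem_mpGroup
    ⟨Equiv.addRight 1, measurePreserving_uniformOn_univ _, measurePreserving_uniformOn_univ _⟩
    fun c => if c = 0 then s * r else s⟩

open scoped Fin.CommRing in
theorem clockShift_pow_apply {s r : MPGroup ν} (h : Commute s r) (n : ℕ) (p : Fin q × Z) :
    (clockShift q s r ^ n).1 p = (p.1 + (n : Fin q),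
      (s ^ n * r ^ ∑ t ∈ Finset.range n, if p.1 + (t : Fin q) = 0 then 1 else 0).1 p.2) := by
  induction n with
  | zero => simp
  | succ n ih =>
    rw [pow_succ', Subgroup.coe_mul, Equiv.Perm.mul_apply, ih, Finset.sum_range_succ]
    refine Prod.ext (by simp [clockShift, add_assoc]) ?_
    change ((if p.1 + (n : Fin q) = 0 then s * r else s) * (s ^ n * r ^ _)).1 p.2 = _
    split_ifs
    · rw [mul_assoc, ← mul_assoc r, ← (h.pow_left n).eq, mul_assoc, ← mul_assoc s, ← pow_succ',
        ← pow_succ']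
    · rw [← mul_assoc, ← pow_succ', add_zero]

theorem clockShift_pow_period {s r : MPGroup ν} (h : Commute s r) (p : Fin q × Z) :
    (clockShift q s r ^ q).1 p = (p.1, (s ^ q * r).1 p.2) := by
  open scoped Fin.CommRing in
  have hzero : ∑ t ∈ Finset.range q, (if p.1 + (t : Fin q) = 0 then 1 else 0) = 1 := by
    rw [Finset.sum_range fun t => if p.1 + (t : Fin q) = 0 then 1 else 0]
    simp [add_eq_zero_iff_eq_neg']
  rw [clockShift_pow_apply q h, hzero, pow_one]
  simp

end Clock

section IndependentPerturbation

open ProbabilityTheory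

theorem finRotate_pow_apply_zero {L : ℕ} [NeZero L] (i : Fin L) :
    (finRotate L ^ (i : ℕ)) 0 = i := by
  open scoped Fin.CommRing in
  have hcast (n : ℕ) : (finRotate L ^ n) 0 = (n : Fin L) := by
    induction n with
    | zero => simp
    | succ n ih => rw [pow_succ', Equiv.Perm.mul_apply, ih, finRotate_apply, Nat.cast_succ]
  rw [hcast, Fin.cast_val_eq_self]

variable {X : Type*} [MeasurableSpace X] {μ : Measure X} [IsProbabilityMeasure μ]
  (q L : ℕ) [NeZero q]

theorem measurePreserving_clock_coordinate (i : Fin L) :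
    MeasurePreserving (fun p : Fin q × (Fin L → X) => p.2 i)
      ((uniformOn (.univ : Set (Fin q))).prod (Measure.pi fun _ : Fin L => μ)) μ :=
  (measurePreserving_eval (fun _ : Fin L => μ) i).comp measurePreserving_snd

variable [NeZero L]

/-- The clock skew product over `X ^ L` that acts diagonally by `s` and, once in every `q` steps,
also rotates the coordinates. -/
def rotatingClockShift (s : MPGroup μ) :
    MPGroup ((uniformOn (.univ : Set (Fin q))).prod (Measure.pi fun _ : Fin L => μ)) :=
  clockShift q (diagonalAction (Fin L) s) (coordinatePermutation μ (finRotate L)⁻¹)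

theorem rotatingClockShift_apply_zero_of_ne {s : MPGroup μ} {p : Fin q × (Fin L → X)}
    (hp : p.1 ≠ 0) : ((rotatingClockShift q L s).1 p).2 0 = s.1 (p.2 0) := by
  have h : ((rotatingClockShift q L s).1 p).2 = (if p.1 = 0 then
    diagonalAction (Fin L) s * (coordinatePermutation μ (finRotate L)⁻¹) else
    diagonalAction (Fin L) s).1 p.2 := rfl
  rw [h, if_neg hp]
  rfl

theorem rotatingClockShift_pow_apply_zero (s : MPGroup μ) (i : Fin L)
    (p : Fin q × (Fin L → X)) :
    (((rotatingClockShift q L s ^ q) ^ (i : ℕ)).1 p).2 0 = ((s ^ q) ^ (i : ℕ)).1 (p.2 i) := by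
  have hcomm := commute_diagonalAction_coordinatePermutation s (finRotate L)⁻¹
  have hperiods (n : ℕ) : (((rotatingClockShift q L s ^ q) ^ n).1 p).2 =
      ((diagonalAction (Fin L) s ^ q * coordinatePermutation μ (finRotate L)⁻¹) ^ n).1 p.2 := by
    induction n with
    | zero => rfl
    | succ n ih =>
      rw [pow_succ', pow_succ', Subgroup.coe_mul, Equiv.Perm.mul_apply, rotatingClockShift,
        clockShift_pow_period q hcomm]
      exact congrArg (diagonalAction (Fin L) s ^ q * coordinatePermutation μ (finRotate L)⁻¹).1 ih
  rw [hperiods, (hcomm.pow_left q).mul_pow, ← map_pow, ← map_pow, ← map_pow, inv_pow]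
  change ((s ^ q) ^ (i : ℕ)).1 (p.2 ((finRotate L ^ (i : ℕ)) 0)) = _
  rw [finRotate_pow_apply_zero]

theorem partitionEntropy_itinerary_rotatingClockShift (s : MPGroup μ) {k : ℕ} {ξ : X → Fin k}
    (hξ : Measurable ξ) :
    partitionEntropy ((uniformOn (.univ : Set (Fin q))).prod (Measure.pi fun _ : Fin L => μ))
      (itinerary (rotatingClockShift q L s ^ q).1 (fun p => ξ (p.2 0)) L) =
      L * partitionEntropy μ ξ := by
  have hmp (i : Fin L) : MeasurePreserving ((s ^ q) ^ (i : ℕ)).1 μ μ := ((s ^ q) ^ (i : ℕ)).2.1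
  have hitinerary : itinerary (rotatingClockShift q L s ^ q).1 (fun p => ξ (p.2 0)) L =
      (fun (y : Fin L → X) (i : Fin L) => (ξ ∘ ((s ^ q) ^ (i : ℕ)).1) (y i)) ∘ Prod.snd := by
    funext p i
    rw [itinerary, ← coe_pow_eq_iterate, rotatingClockShift_pow_apply_zero]
    rfl
  have hlabel (i : Fin L) : Measurable (ξ ∘ ((s ^ q) ^ (i : ℕ)).1) := hξ.comp (hmp i).measurable
  have hlabels : Measurable fun (y : Fin L → X) (i : Fin L) => (ξ ∘ ((s ^ q) ^ (i : ℕ)).1) (y i) :=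
    measurable_pi_lambda _ fun i => (hlabel i).comp (measurable_pi_apply i)
  rw [hitinerary, partitionEntropy_comp_measurePreserving hlabels measurePreserving_snd,
    partitionEntropy_pi hlabel,
    Finset.sum_congr rfl fun i _ => partitionEntropy_comp_measurePreserving hξ (hmp i)]
  simp

variable [StandardBorelSpace X] [NullSingletonClass μ]

theorem exists_independent_perturbation {ι : Type*} [Countable ι] [MeasurableSpace ι]
    [MeasurableSingletonClass ι] (s : MPGroup μ) {P : X → ι} (hP : Measurable P) {k : ℕ}
    {ξ : X → Fin k} (hξ : Measurable ξ) :
    ∃ e : MPGroup μ, μ.real {x | P (e.1 x) ≠ P (s.1 x)} ≤ 1 / q ∧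
      itineraryEntropy ξ L ((e : Aut μ) ^ q) = L * partitionEntropy μ ξ := by
  have hlabel : Measurable fun x => (P x, P (s.1 x), ξ x) :=
    hP.prodMk ((hP.comp s.2.1.measurable).prodMk hξ)
  have hcoord := measurePreserving_clock_coordinate (μ := μ) q L 0
  obtain ⟨e, φ, hφ, he⟩ := exists_mpGroup_pow_label_ae_eq (rotatingClockShift q L s) hlabel
    (hlabel.comp hcoord.measurable)
    (by rw [← Measure.map_map hlabel hcoord.measurable, hcoord.map_eq])
  simp only [Function.comp_apply, Prod.mk.injEq] at he
  refine ⟨e, ?_, ?_⟩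
  · have hbad : {x | P (e.1 x) ≠ P (s.1 x)} ≤ᵐ[μ] φ ⁻¹' ({0} ×ˢ Set.univ) := by
      filter_upwards [he] with x hx
      refine Not.imp_symm fun hclock => ?_
      rw [← pow_one e, (hx 1).1, pow_one, rotatingClockShift_apply_zero_of_ne q L
        fun h => hclock ⟨h, trivial⟩]
      exact (hx 0).2.1.symm
    refine (ENNReal.toReal_mono (measure_ne_top _ _) (measure_mono_ae hbad)).trans_eq ?_
    rw [← measureReal_def, hφ.measureReal_preimage
      ((measurableSet_singleton 0).prod .univ).nullMeasurableSet, measureReal_prod_prod]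
    simp [measureReal_def, uniformOn_univ]
  · have hξ' : Measurable fun p : Fin q × (Fin L → X) => ξ (p.2 0) := hξ.comp hcoord.measurable
    change partitionEntropy μ (itinerary (e ^ q).1 ξ L) = _
    rw [← partitionEntropy_itinerary_rotatingClockShift q L s hξ,
      ← partitionEntropy_comp_measurePreserving
        (measurable_itinerary (rotatingClockShift q L s ^ q).2.1.measurable hξ' L) hφ]
    refine partitionEntropy_congr_ae ?_
    filter_upwards [he] with x hx
    funext i
    simp only [itinerary, ← coe_pow_eq_iterate, Function.comp_apply, ← pow_mul, (hx _).2.2]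

end IndependentPerturbation

/-! ### Category -/

section Category

variable {X : Type*} [MeasurableSpace X] {μ : Measure X} [StandardBorelSpace X]
  [IsProbabilityMeasure μ]

theorem isOpen_exists_lt_itineraryEntropy_pow (A : DenseFamily μ) {k : ℕ} {ξ : X → Fin k}
    (hξ : Measurable ξ) (L : ℕ → ℕ) (a : ℝ) (N : ℕ) :
    letI := halmosMetricSpace A
    IsOpen {T : Aut μ | ∃ j ≥ N, L j * a < itineraryEntropy ξ (L j) (T ^ (j + 1))} := by
  let := halmosMetricSpace A
  have hunion : {T : Aut μ | ∃ j ≥ N, L j * a < itineraryEntropy ξ (L j) (T ^ (j + 1))} =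
      ⋃ j ≥ N, {T : Aut μ | L j * a < itineraryEntropy ξ (L j) (T ^ (j + 1))} := by
    ext T
    simp
  exact hunion ▸ isOpen_biUnion fun j _ =>
    isOpen_lt continuous_const (continuous_itineraryEntropy_pow A hξ (L j) (j + 1))

variable [NullSingletonClass μ]

theorem exists_tendsto_halmos_itineraryEntropy_pow_eq (A : DenseFamily μ) {k : ℕ}
    {ξ : X → Fin k} (hξ : Measurable ξ) {L : ℕ → ℕ} (hL : ∀ j, 0 < L j) (T : Aut μ) :
    letI := halmosMetricSpace A
    ∃ S : ℕ → Aut μ, Tendsto S atTop (nhds T) ∧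
      ∀ j, itineraryEntropy ξ (L j) (S j ^ (j + 1)) = L j * partitionEntropy μ ξ := by
  let := halmosMetricSpace A
  rcases T with ⟨t⟩
  have hP (j : ℕ) : Measurable fun x (i : Fin j) => x ∈ A.set i :=
    measurable_pi_lambda _ fun i => measurable_mem.2 (A.measurableSet i)
  have (j : ℕ) : NeZero (L j) := ⟨(hL j).ne'⟩
  choose e he hentropy using fun j : ℕ =>
    exists_independent_perturbation (j + 1) (L j) t (hP j) hξ
  refine ⟨fun j => e j, (tendsto_nhds_halmos_iff A).2 fun B hB => ?_, hentropy⟩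
  refine tendsto_measureReal_symmDiff_of_denseFamily A (fun j => (e j).2.1) (fun _ => t.2.1)
    (fun i => ?_) hB
  refine squeeze_zero' (.of_forall fun _ => measureReal_nonneg) ?_
    tendsto_one_div_add_atTop_nhds_zero_nat
  filter_upwards [eventually_gt_atTop i] with j hj
  refine (measureReal_mono ?_).trans ((he j).trans_eq (by push_cast; rfl))
  intro x hx hlabel
  have hmem : ((e j).1 x ∈ A.set i) = (t.1 x ∈ A.set i) := congrFun hlabel ⟨i, hj⟩
  simp [Set.mem_symmDiff, hmem] at hx

theorem dense_exists_lt_itineraryEntropy_pow (A : DenseFamily μ) {k : ℕ} {ξ : X → Fin k}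
    (hξ : Measurable ξ) {L : ℕ → ℕ} (hL : ∀ j, 0 < L j) {a : ℝ} (ha : a < partitionEntropy μ ξ)
    (N : ℕ) :
    letI := halmosMetricSpace A
    Dense {T : Aut μ | ∃ j ≥ N, L j * a < itineraryEntropy ξ (L j) (T ^ (j + 1))} := by
  let := halmosMetricSpace A
  intro T
  obtain ⟨S, hST, hS⟩ := exists_tendsto_halmos_itineraryEntropy_pow_eq A hξ hL T
  refine mem_closure_of_tendsto hST ?_
  filter_upwards [eventually_ge_atTop N] with j hj
  exact ⟨j, hj, (mul_lt_mul_of_pos_left ha (Nat.cast_pos.2 (hL j))).trans_eq (hS j).symm⟩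

theorem isMeagre_conjSaturation (A : DenseFamily μ) {K : Set (Aut μ)} :
    letI := halmosMetricSpace A
    IsCompact K → (∀ S ∈ K, ksEntropy S = 0) → IsMeagre (conjSaturation K) := by
  let := halmosMetricSpace A
  intro hK hK0
  have hlog : (0 : ℝ) < Real.log 2 := Real.log_pos one_lt_two
  obtain ⟨B, hB, hBhalf⟩ := exists_measureReal_eq_half μ
  have hBentropy : Real.log 2 / 2 < partitionEntropy μ (twoSetLabel B) := by
    rw [partitionEntropy_twoSetLabel hB, hBhalf, one_div, Real.binEntropy_two_inv]
    exact half_lt_self hlog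
  choose L hL hLK using fun j : ℕ => exists_uniform_itinerary_length A hK hK0 j
    (Nat.succ_pos j) (ε := 1 / ((j : ℝ) + 1)) (by positivity)
  have hlarge : (⋂ N, {T : Aut μ | ∃ j ≥ N, L j * (Real.log 2 / 2) <
      itineraryEntropy (twoSetLabel B) (L j) (T ^ (j + 1))}) ∈ residual (Aut μ) :=
    countable_iInter_mem.2 fun N => residual_of_dense_open
      (isOpen_exists_lt_itineraryEntropy_pow A (measurable_twoSetLabel hB) L _ N)
      (dense_exists_lt_itineraryEntropy_pow A (measurable_twoSetLabel hB) hL hBentropy N)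
  refine mem_of_superset hlarge ?_
  rintro _ hT ⟨S, hS, ⟨t⟩, rfl⟩
  obtain ⟨N, hN⟩ := eventually_atTop.1 (eventually_itineraryEntropy_pow_le_of_denseFamily A
    (fun j => hLK j S hS) (t.2.2.measurable hB) (half_pos hlog))
  obtain ⟨j, hj, hlt⟩ := Set.mem_iInter.1 hT N
  have hconj : ((t : Aut μ)⁻¹ * S * t) ^ (j + 1) = (t : Aut μ)⁻¹ * S ^ (j + 1) * t := by
    simpa using conj_pow (a := (t : Aut μ)⁻¹) (b := S) (i := j + 1)
  refine (hN j hj).not_gt (hlt.trans_eq ?_)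
  exact (congrArg _ hconj).trans (itineraryEntropy_conj (measurable_twoSetLabel hB) _ _ t)

end Category

end HalmosAut

end

theorem mainTheorem1 {X : Type*} [MeasurableSpace X] [StandardBorelSpace X]
    (μ : Measure X) [IsProbabilityMeasure μ] [NullSingletonClass μ]
    (A : DenseFamily μ) (K : Set (Aut μ)) :
    letI := halmosMetricSpace A
    IsCompact K → (∀ S ∈ K, ksEntropy S = 0) →
      IsMeagre (conjSaturation K) ∧ ¬ IsGeneric (conjSaturation K) := by
  let := halmosMetricSpace A
  intro hK hK0
  have hmeagre := isMeagre_conjSaturation A hK hK0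
  refine ⟨hmeagre, ?_⟩
  rintro ⟨G, hGK, hGδ, hGd⟩
  have := completeSpace_halmos A
  exact not_isMeagre_of_isGδ_of_dense hGδ hGd (hmeagre.mono hGK)
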